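/- **Setting.** Let $M$ be a smooth (finite-dimensional, Hausdorff, second countable) manifold, $\tau\colon T^*M\to M$ its cotangent bundle, and $\mathcal G\subset T^*M$ an open neighbourhood of the zero section, with the symplectic form $\omega=d(p\,dq)=dp\wedge dq$. (A local symplectic groupoid of a Poisson manifold, realized inside $T^*M$, is such a $\mathcal G$.) For a one-form $\eta$ on $\mathcal G$ let $X_\eta$ be the vector field with $\omega(X_\eta,\cdot)=-\eta$, and let $$[\eta,\theta]=\mathcal L_{X_\eta}\theta-\mathcal L_{X_\theta}\eta-d\,\omega(X_\eta,X_\theta).$$ Let $Z$ be the set of smooth closed one-forms $\zeta$ on $M$ whose graph lies in $\mathcal G$; such a $\zeta$ is also viewed as a map $M\to\mathcal G$. Fix a smooth one-form $\xi\in\Omega^1(\mathcal G)$. *The space $J_\xi^\infty$.* For families $f=(f_\zeta)_{\zeta\in Z}$ and $g=(g_\zeta)_{\zeta\in Z}$ of one-forms on $\mathcal G$ let $\eta(f,g)_\zeta=[f_\zeta,\tau^*\zeta^*g_\zeta]$. A family $f$ defines the map $\zeta\mapsto\zeta^*f_\zeta$; thus $\eta(f,g)$ defines $\zeta\mapsto\zeta^*[f_\zeta,\tau^*\zeta^*g_\zeta]$.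 The real vector space $J_\xi^\infty$ is the smallest space of such families that contains the constant family $\xi$ and is stable under $\eta$. A product $\triangleright$ on $J_\xi^\infty$ means an $\mathbb R$-bilinear map $J_\xi^\infty\times J_\xi^\infty\to J_\xi^\infty$ such that, for all $f,g,h\in J_\xi^\infty$, $$h\triangleright\xi=\eta(\xi,h),\qquad h\triangleright\eta(f,g)=\eta(h\triangleright f,g)+\eta(f,h\triangleright g).\tag{1}$$ *Trees.* Let $T$ be the set of non-planar rooted (Butcher) trees, where $(\tau_n,\dots,\tau_1)_\bullet$ denotes the tree with branches $\tau_n,\dots,\tau_1$ at the root, and $\mathcal T=\mathrm{Span}_{\mathbb R}(T)$. The bilinear grafting product $\sigma\curvearrowright\tau$ is, for trees $\sigma,\tau$, the sum, with multiplicity, of all trees obtained by grafting the root of $\sigma$ on a node of $\tau$. **Proposition.** 1. $(\mathcal T,\curvearrowright)$ is a (left) pre-Lie algebra. 2. There is a unique linear map $\mathcal F^\xi\colon\mathcal T\to J_\xi^\infty$, the elementary differential, with $\mathcal F^\xi(\bullet)=\xi$ and, for all trees $\tau_1,\dots,\tau_n$ (in any order) and all $\zeta\in Z$, $$\mathcal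 F^\xi\big((\tau_n,\dots,\tau_1)_\bullet\big)_\zeta=[[\dots[\xi,\tau^*\zeta^*\mathcal F^\xi(\tau_1)_\zeta],\dots],\tau^*\zeta^*\mathcal F^\xi(\tau_n)_\zeta].$$ 3. For every product $\triangleright$ satisfying (1), $(J_\xi^\infty,\triangleright)$ is a (left) pre-Lie algebra, i.e. $(f\triangleright g)\triangleright h-f\triangleright(g\triangleright h)=(g\triangleright f)\triangleright h-g\triangleright(f\triangleright h)$, and $\mathcal F^\xi$ is a morphism of pre-Lie algebras: $$\mathcal F^\xi(\tau_2\curvearrowright\tau_1)=\mathcal F^\xi(\tau_2)\triangleright\mathcal F^\xi(\tau_1)\qquad(\tau_1,\tau_2\in\mathcal T).$$ 4. If $\xi$ maps closed forms to closed forms, i.e. $\zeta^*\xi$ is closed for every $\zeta\in Z$ (for instance, if $\xi$ is closed), then there is exactly one product $\triangleright$ satisfying (1). -/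

import Mathlib

open scoped Manifold ContDiff

noncomputable section

/-! ## Butcher trees and grafting -/

/-- Planar rooted trees: `node [τₙ, …, τ₁]` has the trees `τₙ, …, τ₁` plugged to its root. -/
inductive PlanarTree : Type
  | node : List PlanarTree → PlanarTree

namespace PlanarTree

/-- One reordering step: permute the branches at the root, or reorder inside one branch. -/
inductive Reorder : PlanarTree → PlanarTree → Prop
  | perm {l l' : List PlanarTree} : l.Perm l' → Reorder (node l) (node l')
  | branch (l r : List PlanarTree) {a b : PlanarTree} :
      Reorder a b → Reorder (node (l ++ a :: r)) (node (l ++ b :: r))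

mutual
/-- The list (with multiplicity) of all trees obtained by grafting the root of `s` on a node of the
given tree. -/
def graft (s : PlanarTree) : PlanarTree → List PlanarTree
  | node ts => node (s :: ts) :: (graftForest s ts).map node
/-- The same for a list of trees: all ways of grafting `s` on a node of one of the trees. -/
def graftForest (s : PlanarTree) : List PlanarTree → List (List PlanarTree)
  | [] => []
  | t :: ts => (graft s t).map (fun u => u :: ts) ++ (graftForest s ts).map (fun us => t :: us)
end

end PlanarTree

/-- Non-planar Butcher trees: the order of the branches does not matter. -/
def ButcherTree : Type := Quot PlanarTree.Reorder

namespace ButcherTree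

/-- The non-planar tree represented by a planar one. -/
def mk (t : PlanarTree) : ButcherTree := Quot.mk _ t

/-- The multiset of non-planar trees of a list of planar trees. -/
def forest (ts : List PlanarTree) : Multiset ButcherTree := (ts.map mk : List ButcherTree)

/-- A planar representative. -/
def rep (τ : ButcherTree) : PlanarTree := Quot.out τ

theorem mk_rep (τ : ButcherTree) : mk (rep τ) = τ := Quot.out_eq τ

/-- The tree with a given multiset of branches (defined through representatives). -/
def ofForest (m : Multiset ButcherTree) : ButcherTree :=
  mk (PlanarTree.node (m.toList.map rep))

theorem mk_branch (l r : List PlanarTree) {a b : PlanarTree} (h : mk a = mk b) :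
    mk (.node (l ++ a :: r)) = mk (.node (l ++ b :: r)) := by
  have h' := Quot.eqvGen_exact h
  induction h' with
  | rel x y hxy => exact Quot.sound (.branch l r hxy)
  | refl x => rfl
  | symm x y hxy ih => exact (ih (Quot.eqvGen_sound hxy)).symm
  | trans x y z h1 h2 ih1 ih2 =>
    exact (ih1 (Quot.eqvGen_sound h1)).trans (ih2 (Quot.eqvGen_sound h2))

theorem mk_node_of_map_eq (p us vs : List PlanarTree) (h : us.map mk = vs.map mk) :
    mk (.node (p ++ us)) = mk (.node (p ++ vs)) := by
  induction us generalizing p vs with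
  | nil =>
    cases vs with
    | nil => rfl
    | cons v vs => simp at h
  | cons u us ih =>
    cases vs with
    | nil => simp at h
    | cons v vs =>
      simp only [List.map_cons, List.cons.injEq] at h
      rw [mk_branch p us h.1]
      have := ih (p ++ [v]) vs h.2
      simpa using this

theorem mk_node (us : List PlanarTree) : mk (.node us) = ofForest (forest us) := by
  have hp : ((forest us).toList).Perm (us.map mk) := by
    rw [← Multiset.coe_eq_coe, Multiset.coe_toList]; rfl
  have h1 : mk (.node us) = mk (.node ((us.map mk).map rep)) :=
    mk_node_of_map_eq [] _ _ (by simp [Function.comp_def, mk_rep])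
  rw [h1]
  exact (Quot.sound (.perm (hp.map rep))).symm

/-- The multiset of trees obtained by grafting, for a planar representative of the second tree. -/
def graftAux (s t : PlanarTree) : Multiset ButcherTree := forest (PlanarTree.graft s t)

def graftForestAux (s : PlanarTree) (ts : List PlanarTree) : Multiset (Multiset ButcherTree) :=
  ((PlanarTree.graftForest s ts).map forest : List (Multiset ButcherTree))

theorem graftAux_node (s : PlanarTree) (ts : List PlanarTree) :
    graftAux s (.node ts) =
      ofForest (mk s ::ₘ forest ts) ::ₘ (graftForestAux s ts).map ofForest := by
  simp [graftAux, graftForestAux, forest, PlanarTree.graft, mk_node, Function.comp_def]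

theorem graftForestAux_nil (s : PlanarTree) : graftForestAux s [] = 0 := by
  simp [graftForestAux, PlanarTree.graftForest]

theorem graftForestAux_cons (s t : PlanarTree) (ts : List PlanarTree) :
    graftForestAux s (t :: ts) = (graftAux s t).map (fun u => u ::ₘ forest ts) +
      (graftForestAux s ts).map (fun us => mk t ::ₘ us) := by
  simp [graftAux, graftForestAux, forest, PlanarTree.graftForest, Function.comp_def]

theorem forest_cons (t : PlanarTree) (ts : List PlanarTree) :
    forest (t :: ts) = mk t ::ₘ forest ts := by
  simp [forest]

theorem forest_perm {l l' : List PlanarTree} (h : l.Perm l') : forest l = forest l' :=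
  Multiset.coe_eq_coe.2 (h.map mk)

mutual
theorem graftAux_congr_left {s s' : PlanarTree} (h : mk s = mk s') :
    (t : PlanarTree) → graftAux s t = graftAux s' t
  | .node ts => by rw [graftAux_node, graftAux_node, h, graftForestAux_congr_left h ts]
theorem graftForestAux_congr_left {s s' : PlanarTree} (h : mk s = mk s') :
    (ts : List PlanarTree) → graftForestAux s ts = graftForestAux s' ts
  | [] => by rw [graftForestAux_nil, graftForestAux_nil]
  | t :: ts => by
    rw [graftForestAux_cons, graftForestAux_cons, graftAux_congr_left h t,
      graftForestAux_congr_left h ts]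
end

theorem graftForestAux_perm (s : PlanarTree) {l l' : List PlanarTree} (h : l.Perm l') :
    graftForestAux s l = graftForestAux s l' := by
  induction h with
  | nil => rfl
  | cons x hp ih => rw [graftForestAux_cons, graftForestAux_cons, ih, forest_perm hp]
  | swap x y l =>
    simp only [graftForestAux_cons, forest_cons, Multiset.map_add, Multiset.map_map,
      Function.comp_def]
    rw [add_left_comm]
    simp only [Multiset.cons_swap]
  | trans _ _ ih1 ih2 => exact ih1.trans ih2

theorem graftForestAux_branch (s : PlanarTree) (l r : List PlanarTree) {a b : PlanarTree}
    (h : mk a = mk b) (hg : graftAux s a = graftAux s b) :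
    graftForestAux s (l ++ a :: r) = graftForestAux s (l ++ b :: r) := by
  rw [graftForestAux_perm s List.perm_middle, graftForestAux_perm s (List.perm_middle (a := b)),
    graftForestAux_cons, graftForestAux_cons, h, hg]

theorem graftAux_congr_right (s : PlanarTree) {t t' : PlanarTree} (h : t.Reorder t') :
    graftAux s t = graftAux s t' := by
  induction h with
  | perm hp => rw [graftAux_node, graftAux_node, forest_perm hp, graftForestAux_perm s hp]
  | branch l r hab ih =>
    have hm : mk _ = mk _ := Quot.sound hab
    rw [graftAux_node, graftAux_node, graftForestAux_branch s l r hm ih,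
      forest_perm List.perm_middle, forest_perm (List.perm_middle (l₂ := r)), forest_cons,
      forest_cons, hm]

/-- The multiset of all trees obtained by grafting the root of `σ` on a node of `τ`. -/
def graft : ButcherTree → ButcherTree → Multiset ButcherTree :=
  Quot.lift₂ graftAux (fun s _ _ h => graftAux_congr_right s h)
    (fun _ _ t h => graftAux_congr_left (Quot.sound h) t)

end ButcherTree

/-- The real vector space spanned by the Butcher trees. -/
abbrev TreeSpace : Type := ButcherTree →₀ ℝ

/-- The grafting product on the span of the Butcher trees: the bilinear map which sends `(σ, τ)` to
the sum (with multiplicity) of all trees obtained by grafting the root of `σ` on a node of `τ`. -/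
def grafting : TreeSpace →ₗ[ℝ] TreeSpace →ₗ[ℝ] TreeSpace :=
  Finsupp.linearCombination ℝ fun σ => Finsupp.linearCombination ℝ fun τ =>
    ((ButcherTree.graft σ τ).map fun ρ => Finsupp.single ρ (1 : ℝ)).sum

/-- Left pre-Lie identity of a bilinear product. -/
def IsLeftPreLie {V : Type*} [AddCommGroup V] [Module ℝ V] (m : V →ₗ[ℝ] V →ₗ[ℝ] V) : Prop :=
  ∀ x y z : V, m (m x y) z - m x (m y z) = m (m y x) z - m y (m x z)

/-! ## One-forms on manifolds -/

section Forms

variable {E : Type*} [NormedAddCommGroup E] [NormedSpace ℝ E] {H : Type*} [TopologicalSpace H]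
  (I : ModelWithCorners ℝ E H) (N : Type*) [TopologicalSpace N] [ChartedSpace H N]

/-- Arbitrary (not necessarily smooth) one-forms. -/
abbrev OneForm : Type _ := (x : N) → TangentSpace I x →L[ℝ] ℝ

/-- Arbitrary (not necessarily smooth) vector fields. -/
abbrev VecField : Type _ := (x : N) → TangentSpace I x

variable {I N}

/-- Smoothness of a one-form, as a section of the cotangent bundle. -/
def IsSmoothForm [IsManifold I ∞ N] (η : OneForm I N) : Prop :=
  ContMDiff I (I.prod 𝓘(ℝ, E →L[ℝ] ℝ)) ∞
    fun x => Bundle.TotalSpace.mk' (E →L[ℝ] ℝ) (E := fun x : N => TangentSpace I x →L[ℝ] ℝ) x (η x)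

/-- Expression of a one-form in the preferred chart at `x`: the pull-back by the inverse chart. -/
def chartForm (η : OneForm I N) (x : N) : E → E →L[ℝ] ℝ := fun y =>
  (η ((extChartAt I x).symm y)).comp (mfderiv 𝓘(ℝ, E) I (extChartAt I x).symm y)

/-- Exterior derivative of a one-form, `dη(v, w) = ∂_v η(w) - ∂_w η(v)`, computed at `x` in the
chart at `x`. -/
def extDer (η : OneForm I N) (x : N) : TangentSpace I x →L[ℝ] TangentSpace I x →L[ℝ] ℝ :=
  let A : E →L[ℝ] E →L[ℝ] ℝ := fderiv ℝ (chartForm η x) (extChartAt I x x)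
  let D : TangentSpace I x →L[ℝ] E := mfderiv I 𝓘(ℝ, E) (extChartAt I x) x
  ((ContinuousLinearMap.precomp ℝ D).comp (A - A.flip)).comp D

/-- Differential of a function. -/
def dFun (f : N → ℝ) : OneForm I N := fun x => mfderiv I 𝓘(ℝ, ℝ) f x

/-- Lie derivative of a one-form, `L_X η = ι_X dη + d(η(X))`. -/
def lieDer (X : VecField I N) (η : OneForm I N) : OneForm I N := fun x =>
  extDer η x (X x) + dFun (fun y => η y (X y)) x

end Forms

section Pullback

variable {E : Type*} [NormedAddCommGroup E] [NormedSpace ℝ E] {H : Type*} [TopologicalSpace H]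
  (I : ModelWithCorners ℝ E H) {N : Type*} [TopologicalSpace N] [ChartedSpace H N]
  {E' : Type*} [NormedAddCommGroup E'] [NormedSpace ℝ E'] {H' : Type*} [TopologicalSpace H']
  (I' : ModelWithCorners ℝ E' H') {N' : Type*} [TopologicalSpace N'] [ChartedSpace H' N']

/-- Pull-back of a one-form by a map `φ : N → N'`. -/
def pullForm (φ : N → N') (η : OneForm I' N') : OneForm I N := fun x =>
  (η (φ x)).comp (mfderiv I I' φ x)

end Pullback

/-! ## Geometry of an open subset of the cotangent bundle -/

section Cotangent

variable (E : Type*) [NormedAddCommGroup E] [NormedSpace ℝ E]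
  (M : Type*) [TopologicalSpace M] [ChartedSpace E M] [IsManifold 𝓘(ℝ, E) ∞ M]

/-- The cotangent bundle `T*M`. -/
abbrev CotangentBundle : Type _ :=
  Bundle.TotalSpace (E →L[ℝ] ℝ) fun x : M => TangentSpace 𝓘(ℝ, E) x →L[ℝ] ℝ

/-- The model of the manifold `T*M` (and of its open subsets). -/
abbrev cotModel : ModelWithCorners ℝ (E × (E →L[ℝ] ℝ)) (ModelProd E (E →L[ℝ] ℝ)) :=
  𝓘(ℝ, E).prod 𝓘(ℝ, E →L[ℝ] ℝ)

variable {E M} (G : TopologicalSpace.Opens (CotangentBundle E M))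

/-- The cotangent projection `τ : G → M`. -/
def cotProj (z : G) : M := z.1.proj

/-- The Liouville form `p dq` on `G`. -/
def liouville : OneForm (cotModel E) G := fun z =>
  (z.1.snd).comp (mfderiv (cotModel E) 𝓘(ℝ, E) (cotProj G) z)

/-- The canonical symplectic form `ω = dp ∧ dq` on `G`. -/
def omega (z : G) :
    TangentSpace (cotModel E) z →L[ℝ] TangentSpace (cotModel E) z →L[ℝ] ℝ :=
  extDer (liouville G) z

/-- The vector field generated by a one-form: `ω(X_η, ·) = -η`. -/
def sharp (η : OneForm (cotModel E) G) : VecField (cotModel E) G := fun z =>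
  (omega G z).inverse (-(η z))

/-- The Lie algebroid bracket of one-forms on `G`,
`[η, θ] = L_{X_η} θ - L_{X_θ} η - d (ω(X_η, X_θ))`. -/
def formBracket (η θ : OneForm (cotModel E) G) : OneForm (cotModel E) G :=
  lieDer (sharp G η) θ - lieDer (sharp G θ) η - dFun fun z => omega G z (sharp G η z) (sharp G θ z)

/-- Smooth closed one-forms on `M` whose graph lies in `G`. -/
structure ClosedSection where
  toForm : OneForm 𝓘(ℝ, E) M
  smooth : IsSmoothForm toForm
  closed : ∀ x, extDer toForm x = 0
  graph_mem : ∀ x, (⟨x, toForm x⟩ : CotangentBundle E M) ∈ G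

variable {G}

/-- A closed one-form with graph in `G`, as a map `M → G`. -/
def ClosedSection.toMap (ζ : ClosedSection G) (x : M) : G := ⟨⟨x, ζ.toForm x⟩, ζ.graph_mem x⟩

/-- The pull-back `ζ^* η`, a one-form on `M`. -/
def ClosedSection.pull (ζ : ClosedSection G) (η : OneForm (cotModel E) G) : OneForm 𝓘(ℝ, E) M :=
  pullForm 𝓘(ℝ, E) (cotModel E) ζ.toMap η

variable (G)

/-- One-forms on `G` that depend on a closed one-form `ζ` on `M` with graph in `G`. Such a family
`f` defines the map `ζ ↦ ζ^* f(ζ)` into one-forms on `M`. -/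
abbrev FormFamily : Type _ := ClosedSection G → OneForm (cotModel E) G

variable {G}

/-- `η(f, g) : ζ ↦ [f, τ^* ζ^* g]`, a family whose pull-back is `ζ ↦ ζ^*[f, τ^* ζ^* g]`. -/
def etaMap (f g : FormFamily G) : FormFamily G := fun ζ =>
  formBracket G (f ζ) (pullForm (cotModel E) 𝓘(ℝ, E) (cotProj G) (ζ.pull (g ζ)))

/-- The space `J_ξ^∞`: the smallest vector space that contains `ξ` and is stable under `η`. -/
def jetSpace (ξ : OneForm (cotModel E) G) : Submodule ℝ (FormFamily G) :=
  sInf {p | (fun _ => ξ) ∈ p ∧ ∀ f ∈ p, ∀ g ∈ p, etaMap f g ∈ p}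

variable (ξ : OneForm (cotModel E) G)

theorem const_mem_jetSpace : (fun _ => ξ) ∈ jetSpace ξ :=
  Submodule.mem_sInf.2 fun _ hp => hp.1

theorem etaMap_mem_jetSpace {f g : FormFamily G} (hf : f ∈ jetSpace ξ) (hg : g ∈ jetSpace ξ) :
    etaMap f g ∈ jetSpace ξ :=
  Submodule.mem_sInf.2 fun p hp =>
    hp.2 f (Submodule.mem_sInf.1 hf p hp) g (Submodule.mem_sInf.1 hg p hp)

/-- `ξ` as an element of `J_ξ^∞`. -/
def jetGen : jetSpace ξ := ⟨fun _ => ξ, const_mem_jetSpace ξ⟩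

variable {ξ} in
/-- `η` as an operation on `J_ξ^∞`. -/
def jetEta (f g : jetSpace ξ) : jetSpace ξ := ⟨etaMap f g, etaMap_mem_jetSpace ξ f.2 g.2⟩

/-- The defining relations of the product `▷` on `J_ξ^∞`:
`h ▷ ξ = η(ξ, h)` and `h ▷ η(f, g) = η(h ▷ f, g) + η(f, h ▷ g)`. -/
def IsJetProduct (m : jetSpace ξ →ₗ[ℝ] jetSpace ξ →ₗ[ℝ] jetSpace ξ) : Prop :=
  (∀ h, m h (jetGen ξ) = jetEta (jetGen ξ) h) ∧
    ∀ h f g, m h (jetEta f g) = jetEta (m h f) g + jetEta f (m h g)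

mutual
/-- The elementary differential of a planar tree: `F(•) = ξ` and, on the tree with branches
`τₙ, …, τ₁`, the iterated bracket `[[… [ξ, τ^* ζ^* F(τ₁)], …], τ^* ζ^* F(τₙ)]`. -/
def elemDiff : PlanarTree → FormFamily G
  | .node ts => elemDiffForest ts
/-- The iterated bracket along a list of branches. -/
def elemDiffForest : List PlanarTree → FormFamily G
  | [] => fun _ => ξ
  | t :: ts => fun ζ => formBracket G (elemDiffForest ts ζ)
      (pullForm (cotModel E) 𝓘(ℝ, E) (cotProj G) (ζ.pull (elemDiff t ζ)))
end

end Cotangent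

end

noncomputable section

set_option maxSynthPendingDepth 3
set_option linter.unusedSectionVars false

/-! ## Pre-Lie products generated by derivations -/

section Generation

variable {V : Type*} [AddCommGroup V] [Module ℝ V]

-- Write x ◁ y for η on J_ξ^∞, and also for attaching the tree y as a new branch to the root of x.
-- In both cases ◁ is bilinear, one element e (ξ, respectively the one-node tree) generates the
-- space under ◁, and (x ◁ y) ◁ z = (x ◁ z) ◁ y. A product with h ▷ e = e ◁ h for which every h ▷ ·
-- is a derivation of ◁ is then pre-Lie (`isLeftPreLie_of_derivation`). Grafting is such a product,
-- since the nodes of x ◁ y are those of x and those of y; the relations (1) say the same of ▷.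
--
-- Symplectic geometry enters through right-commutativity of η. In canonical coordinates [f, τ^*a]
-- is the derivative of f in the vertical direction (0, a) plus a horizontal term linear in Da and
-- in the fibre component of f (`chartForm_formBracket`); a need not be closed. Two such operators
-- commute by symmetry of second derivatives (`locBracket_comm`). Hence the iterated bracket ignores
-- the order of the branches, F is defined on Butcher trees, it intertwines the two operations ◁, it
-- is onto, and it carries grafting to any admissible ▷ (`map_grafting`).
--
-- So ▷ is unique, and it exists once b ↷ · preserves ker F for every b. The reason is that grafting
-- is a directional derivative: if ψ = ζ^*F(b)_ζ is closed, then F(b ↷ x)_ζ = [F(x)_ζ, τ^*ψ] + d/dt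
-- F(x)_{ζ+tψ} at t = 0 (`chartForm_map_grafting`), which depends on x only through the family F(x).
-- Both sides agree at e, because ξ does not depend on ζ, and both satisfy the same Leibniz rule
-- (`variation_locBracket`). To keep the graph of ζ + tψ in G, ψ is replaced by a compactly
-- supported exact form which agrees with it near the point under consideration.
--
-- Pulling this formula back by ζ exhibits ζ^*F(b ↷ x)_ζ as the derivative of the closed forms
-- (ζ+tψ)^*F(x)_{ζ+tψ}. Closedness therefore passes from b and x to b ↷ x, and as the one-node tree
-- generates all trees under grafting (`generatedBy_grafting`), it holds for all b as soon as it
-- holds for ξ.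

/-- Every subspace which contains `e` and is stable under `b` is the whole space. -/
def GeneratedBy (b : V →ₗ[ℝ] V →ₗ[ℝ] V) (e : V) : Prop :=
  ∀ p : Submodule ℝ V, e ∈ p → (∀ x ∈ p, ∀ y ∈ p, b x y ∈ p) → p = ⊤

/-- The pre-Lie identity says that m([x, y]) equals the commutator of m x and m y, where [x, y] = m
x y - m y x. Their difference is a derivation of `b`, being built from derivations, and at `e` it
reduces to the difference of (e ◁ y) ◁ x and (e ◁ x) ◁ y. Vanishing on a generator, it vanishes
everywhere. -/
theorem isLeftPreLie_of_derivation {b m : V →ₗ[ℝ] V →ₗ[ℝ] V} {e : V} (hgen : GeneratedBy b e)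
    (hcomm : ∀ x y z, b (b x y) z = b (b x z) y) (he : ∀ h, m h e = b e h)
    (hd : ∀ h x y, m h (b x y) = b (m h x) y + b x (m h y)) : IsLeftPreLie m := by
  intro x y z
  let D : V →ₗ[ℝ] V :=
    (m (m x y) - (m x).comp (m y)) - (m (m y x) - (m y).comp (m x))
  suffices h : LinearMap.ker D = ⊤ by
    have := LinearMap.mem_ker.1 (h ▸ Submodule.mem_top : z ∈ LinearMap.ker D)
    exact sub_eq_zero.1 (by simpa [D] using this)
  refine hgen _ ?_ ?_
  · simp only [D, LinearMap.mem_ker, LinearMap.sub_apply, LinearMap.comp_apply, he, hd]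
    rw [hcomm e x y]; abel
  · intro u hu v hv
    simp only [D, LinearMap.mem_ker, LinearMap.sub_apply, LinearMap.comp_apply] at hu hv ⊢
    simp only [hd, map_add]
    -- The mixed terms b (m x u) (m y v) and b (m y u) (m x v) are symmetric in x and y and cancel;
    -- what is left is D u in the first slot plus D v in the second.
    have h1 : b ((m (m x y) u - m x (m y u)) - (m (m y x) u - m y (m x u))) v = 0 := by
      rw [hu]; simp
    have h2 : b u ((m (m x y) v - m x (m y v)) - (m (m y x) v - m y (m x v))) = 0 := by
      rw [hv]; simp
    simp only [map_sub, LinearMap.sub_apply] at h1 h2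
    linear_combination (norm := abel) h1 + h2

-- From generation under ◁ to generation under ▷

/-- The span of the products `(…(e ◁ c₁) ◁ …) ◁ cₙ` with all `cᵢ` in `C`. -/
def rightWords (b : V →ₗ[ℝ] V →ₗ[ℝ] V) (e : V) (C : Submodule ℝ V) : ℕ → Submodule ℝ V
  | 0 => Submodule.span ℝ {e}
  | n + 1 => Submodule.map₂ b (rightWords b e C n) C

/-- For trees, m c x - b x c grafts c on every node except the root. On a word it applies m c to one
letter of `C` at a time, so the length of the word does not change and the letters stay in `C`. -/
theorem rightWords_commutator {b m : V →ₗ[ℝ] V →ₗ[ℝ] V} {e : V} {C : Submodule ℝ V}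
    (hcomm : ∀ x y z, b (b x y) z = b (b x z) y) (he : ∀ h, m h e = b e h)
    (hd : ∀ h x y, m h (b x y) = b (m h x) y + b x (m h y))
    (hC : ∀ x ∈ C, ∀ y ∈ C, m x y ∈ C) {c : V} (hc : c ∈ C) (n : ℕ) :
    ∀ x ∈ rightWords b e C n, m c x - b x c ∈ rightWords b e C n := by
  induction n with
  | zero =>
    intro x hx
    obtain ⟨r, rfl⟩ := Submodule.mem_span_singleton.1 hx
    simp [he]
  | succ n ih =>
    suffices h : rightWords b e C (n + 1) ≤
        (rightWords b e C (n + 1)).comap (m c - b.flip c) by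
      intro x hx; simpa using h hx
    refine Submodule.map₂_le.2 fun x hx d hdC => ?_
    have h1 : b (m c x - b x c) d ∈ rightWords b e C (n + 1) :=
      Submodule.apply_mem_map₂ b (ih x hx) hdC
    have h2 : b x (m c d) ∈ rightWords b e C (n + 1) :=
      Submodule.apply_mem_map₂ b hx (hC c hc d hdC)
    have := add_mem h1 h2
    simp only [Submodule.mem_comap, LinearMap.sub_apply, LinearMap.flip_apply, hd, hcomm x d c]
    convert! this using 1
    simp only [map_sub, LinearMap.sub_apply]; abel

/-- A subspace stable under m is not visibly stable under b. But b x c is m c x minus a combination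
of words of the same length as x, so induction on the length puts all words with letters in `C` into
`C`. -/
theorem rightWords_le {b m : V →ₗ[ℝ] V →ₗ[ℝ] V} {e : V} {C : Submodule ℝ V}
    (hcomm : ∀ x y z, b (b x y) z = b (b x z) y) (he : ∀ h, m h e = b e h)
    (hd : ∀ h x y, m h (b x y) = b (m h x) y + b x (m h y))
    (heC : e ∈ C) (hC : ∀ x ∈ C, ∀ y ∈ C, m x y ∈ C) (n : ℕ) : rightWords b e C n ≤ C := by
  induction n with
  | zero => simpa [rightWords] using heC
  | succ n ih =>
    refine Submodule.map₂_le.2 fun x hx c hc => ?_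
    have h1 := ih (rightWords_commutator hcomm he hd hC hc n x hx)
    simpa using sub_mem (hC c hc x (ih hx)) h1

end Generation

/-! ## Attaching a tree to the root of another tree -/

namespace ButcherTree

theorem forest_rep (m : Multiset ButcherTree) : forest (m.toList.map rep) = m := by
  simp [forest, Function.comp_def, mk_rep]

theorem forest_branch (l r : List PlanarTree) {a b : PlanarTree} (h : mk a = mk b) :
    forest (l ++ a :: r) = forest (l ++ b :: r) := by
  simp [forest, h]

theorem forest_eq_of_reorder {ts us : List PlanarTree}
    (h : (PlanarTree.node ts).Reorder (PlanarTree.node us)) : forest ts = forest us := by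
  cases h with
  | perm hp => exact forest_perm hp
  | branch l r hab => exact forest_branch l r (Quot.sound hab)

/-- The branches at the root. -/
def branches : ButcherTree → Multiset ButcherTree :=
  Quot.lift (fun t => match t with | .node ts => forest ts) fun t u h => by
    cases t; cases u; exact forest_eq_of_reorder h

@[simp] theorem branches_mk (ts : List PlanarTree) : branches (mk (.node ts)) = forest ts := rfl

@[simp] theorem branches_ofForest (m : Multiset ButcherTree) : branches (ofForest m) = m := by
  rw [ofForest, branches_mk, forest_rep]

/-- The tree with one node. -/
def leaf : ButcherTree := ofForest 0

/-- Attach `σ` to the root of `τ`. -/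
def attach (τ σ : ButcherTree) : ButcherTree := ofForest (σ ::ₘ branches τ)

theorem leaf_eq : leaf = mk (.node []) := by rw [mk_node]; rfl

theorem attach_mk (ts : List PlanarTree) (s : PlanarTree) :
    attach (mk (.node ts)) (mk s) = mk (.node (s :: ts)) := by
  rw [attach, branches_mk, mk_node, forest_cons]

theorem attach_ofForest (m : Multiset ButcherTree) (σ : ButcherTree) :
    attach (ofForest m) σ = ofForest (σ ::ₘ m) := by
  rw [attach, branches_ofForest]

theorem attach_comm (τ σ ρ : ButcherTree) :
    attach (attach τ σ) ρ = attach (attach τ ρ) σ := by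
  simp [attach, Multiset.cons_swap]

theorem graft_mk (s t : PlanarTree) : graft (mk s) (mk t) = graftAux s t := rfl

theorem graft_leaf (σ : ButcherTree) : graft σ leaf = {attach leaf σ} := by
  obtain ⟨s, rfl⟩ : ∃ s, mk s = σ := ⟨_, mk_rep σ⟩
  rw [leaf_eq, graft_mk, graftAux_node, graftForestAux_nil, attach_mk, mk_node, forest_cons]
  simp

/-- The nodes of the composite tree are the nodes of τ, its root included, and the nodes of σ. This
is the Leibniz rule for grafting over attaching. -/
theorem graft_attach (ρ τ σ : ButcherTree) :
    graft ρ (attach τ σ) =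
      (graft ρ τ).map (fun x => attach x σ) + (graft ρ σ).map (attach τ) := by
  obtain ⟨r, rfl⟩ : ∃ s, mk s = ρ := ⟨_, mk_rep ρ⟩
  obtain ⟨⟨ts⟩, rfl⟩ : ∃ s, mk s = τ := ⟨_, mk_rep τ⟩
  obtain ⟨s, rfl⟩ : ∃ s, mk s = σ := ⟨_, mk_rep σ⟩
  rw [attach_mk, graft_mk, graft_mk, graft_mk, graftAux_node, graftAux_node, graftForestAux_cons]
  simp only [Multiset.map_add, Multiset.map_map, Function.comp_def, Multiset.map_cons,
    attach_ofForest, forest_cons, Multiset.cons_add]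
  rw [Multiset.cons_swap, add_comm]
  rfl

/-- Peeling the first branch off the root leaves two smaller trees, so the one-node tree generates
all trees under attaching. -/
theorem attach_induction {P : ButcherTree → Prop} (hl : P leaf)
    (ha : ∀ τ σ, P τ → P σ → P (attach τ σ)) (τ : ButcherTree) : P τ := by
  obtain ⟨t, rfl⟩ : ∃ s, mk s = τ := ⟨_, mk_rep τ⟩
  exact PlanarTree.rec (motive_1 := fun t => P (mk t)) (motive_2 := fun ts => P (mk (.node ts)))
    (fun _ h => h) (leaf_eq ▸ hl) (fun t ts h1 h2 => attach_mk ts t ▸ ha _ _ h2 h1) t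

end ButcherTree

open ButcherTree

/-- The bilinear extension of `ButcherTree.attach`. -/
def attaching : TreeSpace →ₗ[ℝ] TreeSpace →ₗ[ℝ] TreeSpace :=
  Finsupp.linearCombination ℝ fun τ => Finsupp.linearCombination ℝ fun σ =>
    Finsupp.single (attach τ σ) (1 : ℝ)

/-- The one-node tree as a vector. -/
def treeGen : TreeSpace := Finsupp.single leaf 1

theorem attaching_single (τ σ : ButcherTree) :
    attaching (Finsupp.single τ 1) (Finsupp.single σ 1) = Finsupp.single (attach τ σ) 1 := by
  simp [attaching]

theorem grafting_single (σ τ : ButcherTree) :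
    grafting (Finsupp.single σ 1) (Finsupp.single τ 1) =
      ((graft σ τ).map fun ρ => Finsupp.single ρ (1 : ℝ)).sum := by
  simp [grafting]

theorem attaching_comm (x y z : TreeSpace) :
    attaching (attaching x y) z = attaching (attaching x z) y := by
  suffices h : attaching.compr₂ attaching =
      (LinearMap.lflip.comp (attaching.compr₂ attaching) : _) by
    exact congrArg (fun f => f x y z) h
  ext τ σ ρ : 6
  simp [attaching_single, attach_comm τ σ ρ]

theorem grafting_treeGen (h : TreeSpace) : grafting h treeGen = attaching treeGen h := by
  suffices e : grafting.flip treeGen = attaching treeGen from congrArg (fun f => f h) e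
  ext σ : 2
  simp [treeGen, grafting_single, attaching_single, graft_leaf]

theorem grafting_attaching (h x y : TreeSpace) :
    grafting h (attaching x y) = attaching (grafting h x) y + attaching x (grafting h y) := by
  -- Both sides are trilinear, so basis trees suffice; there the identity is `graft_attach`, with
  -- multisets turned into sums.
  suffices key : ∀ (ρ τ σ : ButcherTree),
      grafting (Finsupp.single ρ 1) (attaching (Finsupp.single τ 1) (Finsupp.single σ 1)) =
        attaching (grafting (Finsupp.single ρ 1) (Finsupp.single τ 1)) (Finsupp.single σ 1) +
        attaching (Finsupp.single τ 1) (grafting (Finsupp.single ρ 1) (Finsupp.single σ 1)) by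
    induction h using Finsupp.induction_linear with
    | zero => simp
    | add f g hf hg => simp only [map_add, LinearMap.add_apply, hf, hg]; abel
    | single ρ c =>
    induction x using Finsupp.induction_linear with
    | zero => simp
    | add f g hf hg => simp only [map_add, LinearMap.add_apply, hf, hg]; abel
    | single τ d =>
    induction y using Finsupp.induction_linear with
    | zero => simp
    | add f g hf hg => simp only [map_add, hf, hg]; abel
    | single σ k =>
    rw [← mul_one c, ← mul_one d, ← mul_one k, ← smul_eq_mul, ← smul_eq_mul, ← smul_eq_mul,
      ← Finsupp.smul_single, ← Finsupp.smul_single, ← Finsupp.smul_single]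
    simp only [map_smul, LinearMap.smul_apply, key, smul_add, smul_comm c d]
  intro ρ τ σ
  rw [attaching_single, grafting_single, grafting_single, grafting_single, graft_attach,
    Multiset.map_add, Multiset.sum_add, Multiset.map_map, Multiset.map_map]
  have h1 : ∀ s : Multiset ButcherTree,
      attaching (s.map fun ρ => Finsupp.single ρ (1 : ℝ)).sum (Finsupp.single σ 1) =
        (s.map ((fun ρ => Finsupp.single ρ (1 : ℝ)) ∘ fun x => attach x σ)).sum := fun s => by
    induction s using Multiset.induction_on with
    | empty => simp
    | cons a s ih => simp [ih, attaching_single]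
  have h2 : ∀ s : Multiset ButcherTree,
      attaching (Finsupp.single τ 1) (s.map fun ρ => Finsupp.single ρ (1 : ℝ)).sum =
        (s.map ((fun ρ => Finsupp.single ρ (1 : ℝ)) ∘ attach τ)).sum := fun s => by
    induction s using Multiset.induction_on with
    | empty => simp
    | cons a s ih => simp [ih, attaching_single]
  rw [h1, h2]

theorem eq_top_of_single_mem {p : Submodule ℝ TreeSpace}
    (h : ∀ τ, Finsupp.single τ (1 : ℝ) ∈ p) : p = ⊤ := by
  refine eq_top_iff.2 fun x _ => ?_
  induction x using Finsupp.induction_linear with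
  | zero => exact zero_mem p
  | add f g hf hg => exact add_mem (hf trivial) (hg trivial)
  | single τ c => simpa using p.smul_mem c (h τ)

theorem generatedBy_attaching : GeneratedBy attaching treeGen := fun p h0 h =>
  eq_top_of_single_mem fun τ => by
    induction τ using attach_induction with
    | hl => exact h0
    | ha τ σ h1 h2 => rw [← attaching_single]; exact h _ h1 _ h2

theorem isLeftPreLie_grafting : IsLeftPreLie grafting :=
  isLeftPreLie_of_derivation generatedBy_attaching attaching_comm grafting_treeGen
    grafting_attaching

/-- The Butcher trees are generated by the one-node tree under grafting. -/
theorem generatedBy_grafting : GeneratedBy grafting treeGen := fun C h0 hC =>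
  eq_top_of_single_mem fun τ => by
    -- Every tree is a word over its branches. By induction the branches are themselves words, hence
    -- lie in `C`, and then so does the whole tree.
    have hle := rightWords_le attaching_comm grafting_treeGen grafting_attaching h0 hC
    suffices h : ∃ n, Finsupp.single τ (1 : ℝ) ∈ rightWords attaching treeGen C n from
      hle _ h.choose_spec
    induction τ using attach_induction with
    | hl => exact ⟨0, Submodule.subset_span rfl⟩
    | ha τ σ h1 h2 =>
      obtain ⟨n, hn⟩ := h1
      exact ⟨n + 1, attaching_single τ σ ▸
        Submodule.apply_mem_map₂ _ hn (hle _ h2.choose_spec)⟩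

/-! ## Maps from the span of the Butcher trees -/

section Morphism

variable {W : Type*} [AddCommGroup W] [Module ℝ W] {b : W →ₗ[ℝ] W →ₗ[ℝ] W} {e : W}
  {F : TreeSpace →ₗ[ℝ] W}

theorem map_attaching_of_single
    (h : ∀ τ σ, F (Finsupp.single (attach τ σ) 1) =
      b (F (Finsupp.single τ 1)) (F (Finsupp.single σ 1))) (x y : TreeSpace) :
    F (attaching x y) = b (F x) (F y) := by
  suffices h : attaching.compr₂ F = b.compl₁₂ F F from congrArg (fun f => f x y) h
  ext τ σ : 4
  simp [attaching_single, h]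

theorem range_eq_top_of_generatedBy (hgen : GeneratedBy b e) (he : F treeGen = e)
    (hF : ∀ x y, F (attaching x y) = b (F x) (F y)) : LinearMap.range F = ⊤ := by
  refine hgen _ ⟨_, he⟩ ?_
  rintro _ ⟨x, rfl⟩ _ ⟨y, rfl⟩
  exact ⟨_, hF x y⟩

/-- Grafting by x and m (F x) satisfy the same recursion over attaching, and F respects attaching,
so agreement at the one-node tree propagates to all trees. -/
theorem map_grafting (he : F treeGen = e) (hF : ∀ x y, F (attaching x y) = b (F x) (F y))
    {m : W →ₗ[ℝ] W →ₗ[ℝ] W} (hm : ∀ h, m h e = b e h)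
    (hd : ∀ h x y, m h (b x y) = b (m h x) y + b x (m h y)) (x y : TreeSpace) :
    F (grafting x y) = m (F x) (F y) := by
  suffices h : LinearMap.ker (F.comp (grafting x) - (m (F x)).comp F) = ⊤ by
    have := LinearMap.mem_ker.1 (h ▸ Submodule.mem_top :
      y ∈ LinearMap.ker (F.comp (grafting x) - (m (F x)).comp F))
    exact sub_eq_zero.1 this
  refine generatedBy_attaching _ ?_ ?_
  · simp [grafting_treeGen, hF, he, hm]
  · intro u hu v hv
    simp only [LinearMap.mem_ker, LinearMap.sub_apply, LinearMap.comp_apply, sub_eq_zero]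
      at hu hv ⊢
    rw [grafting_attaching, map_add, hF, hF, hu, hv, hF, hd]

/-- The tree grafted always ends up as an attached branch, so every term keeps a factor F x. No
product on the target is needed. -/
theorem map_grafting_eq_zero_left (hF : ∀ x y, F (attaching x y) = b (F x) (F y))
    {x : TreeSpace} (hx : F x = 0)
    (y : TreeSpace) : F (grafting x y) = 0 := by
  suffices h : LinearMap.ker (F.comp (grafting x)) = ⊤ from
    LinearMap.mem_ker.1 (h ▸ Submodule.mem_top : y ∈ LinearMap.ker (F.comp (grafting x)))
  refine generatedBy_attaching _ ?_ ?_
  · simp [grafting_treeGen, hF, hx]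
  · intro u hu v hv
    simp only [LinearMap.mem_ker, LinearMap.comp_apply] at hu hv ⊢
    simp [grafting_attaching, hF, hu, hv]

/-- The target is the quotient of the tree space by ker F, and the product can only be the one
induced by grafting. It descends in the left argument automatically; in the right argument this is
the hypothesis `hker`. -/
theorem existsUnique_derivation_product (hgen : GeneratedBy b e) (he : F treeGen = e)
    (hF : ∀ x y, F (attaching x y) = b (F x) (F y))
    (hker : ∀ x y, F y = 0 → F (grafting x y) = 0) :
    ∃! m : W →ₗ[ℝ] W →ₗ[ℝ] W, (∀ h, m h e = b e h) ∧
      ∀ h x y, m h (b x y) = b (m h x) y + b x (m h y) := by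
  have hsurj := range_eq_top_of_generatedBy hgen he hF
  -- A linear section s lets the induced product be written down as F (s x ↷ s y); `hm` shows that
  -- the choice of s is immaterial.
  obtain ⟨s, hs⟩ := LinearMap.exists_rightInverse_of_surjective F hsurj
  have hs' : ∀ w, F (s w) = w := fun w => congrArg (fun f => f w) hs
  have hFs : ∀ x, ∃ y, F y = x := fun x => ⟨s x, hs' x⟩
  let m : W →ₗ[ℝ] W →ₗ[ℝ] W := (grafting.compl₁₂ s s).compr₂ F
  have hm : ∀ x y, m (F x) (F y) = F (grafting x y) := by
    intro x y
    have h1 := map_grafting_eq_zero_left hF (x := s (F x) - x) (by simp [hs']) (s (F y))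
    have h2 := hker x (s (F y) - y) (by simp [hs'])
    simp only [map_sub, LinearMap.sub_apply, sub_eq_zero] at h1 h2
    exact h1.trans h2
  refine ⟨m, ⟨fun h => ?_, fun h x y => ?_⟩, fun m' hm' => ?_⟩
  · obtain ⟨h, rfl⟩ := hFs h
    rw [← he, hm, grafting_treeGen, hF]
  · obtain ⟨h, rfl⟩ := hFs h
    obtain ⟨x, rfl⟩ := hFs x
    obtain ⟨y, rfl⟩ := hFs y
    rw [← hF, hm, hm, hm, grafting_attaching, map_add, hF, hF]
  · refine LinearMap.ext₂ fun h x => ?_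
    obtain ⟨h, rfl⟩ := hFs h
    obtain ⟨x, rfl⟩ := hFs x
    rw [hm, map_grafting he hF hm'.1 hm'.2]

end Morphism

/-! ## Families of functions depending smoothly on a real parameter -/

section Parametric

variable {Z : Type*} [NormedAddCommGroup Z] [NormedSpace ℝ Z]
  {F : Type*} [NormedAddCommGroup F] [NormedSpace ℝ F]

/-- Joint smoothness of a one-parameter family of functions. -/
def SmoothFamilyOn (f : ℝ → Z → F) (S : Set ℝ) (Ω : Set Z) : Prop :=
  ContDiffOn ℝ ∞ (fun p : ℝ × Z => f p.1 p.2) (S ×ˢ Ω)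

/-- The derivative of a family with respect to the parameter, at `0`. -/
def paramDeriv (f : ℝ → Z → F) (y : Z) : F := deriv (fun t => f t y) 0

variable {f : ℝ → Z → F} {S : Set ℝ} {Ω : Set Z} {t : ℝ} {y : Z}

theorem smoothFamilyOn_const {g : Z → F} (hg : ContDiffOn ℝ ∞ g Ω) :
    SmoothFamilyOn (fun _ => g) S Ω :=
  hg.comp contDiffOn_snd fun _ h => h.2

theorem SmoothFamilyOn.contDiffOn (hf : SmoothFamilyOn f S Ω) (ht : t ∈ S) :
    ContDiffOn ℝ ∞ (f t) Ω :=
  ContDiffOn.comp (t := S ×ˢ Ω) (g := fun p : ℝ × Z => f p.1 p.2) hf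
    (contDiffOn_const.prodMk contDiffOn_id) fun _ h => ⟨ht, h⟩

theorem SmoothFamilyOn.contDiffAt (hf : SmoothFamilyOn f S Ω) (hS : IsOpen S) (hΩ : IsOpen Ω)
    (ht : t ∈ S) (hy : y ∈ Ω) : ContDiffAt ℝ ∞ (fun p : ℝ × Z => f p.1 p.2) (t, y) :=
  ContDiffOn.contDiffAt hf ((hS.prod hΩ).mem_nhds ⟨ht, hy⟩)

theorem SmoothFamilyOn.hasFDerivAt (hf : SmoothFamilyOn f S Ω) (hS : IsOpen S) (hΩ : IsOpen Ω)
    (ht : t ∈ S) (hy : y ∈ Ω) : HasFDerivAt (fun p : ℝ × Z => f p.1 p.2)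
      (fderiv ℝ (fun p : ℝ × Z => f p.1 p.2) (t, y)) (t, y) :=
  ((hf.contDiffAt hS hΩ ht hy).differentiableAt (by simp)).hasFDerivAt

theorem SmoothFamilyOn.fderiv_eq (hf : SmoothFamilyOn f S Ω) (hS : IsOpen S) (hΩ : IsOpen Ω)
    (ht : t ∈ S) (hy : y ∈ Ω) : fderiv ℝ (f t) y =
      (fderiv ℝ (fun p : ℝ × Z => f p.1 p.2) (t, y)).comp (ContinuousLinearMap.inr ℝ ℝ Z) :=
  (HasFDerivAt.comp y (hf.hasFDerivAt hS hΩ ht hy) (hasFDerivAt_prodMk_right t y)).fderiv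

theorem SmoothFamilyOn.hasDerivAt_eq (hf : SmoothFamilyOn f S Ω) (hS : IsOpen S) (hΩ : IsOpen Ω)
    (ht : t ∈ S) (hy : y ∈ Ω) : HasDerivAt (fun s => f s y)
      (fderiv ℝ (fun p : ℝ × Z => f p.1 p.2) (t, y) (1, 0)) t :=
  HasFDerivAt.comp_hasDerivAt (l := fun p : ℝ × Z => f p.1 p.2) t
    (hf.hasFDerivAt hS hΩ ht hy) ((hasDerivAt_id t).prodMk (hasDerivAt_const t y))

theorem SmoothFamilyOn.hasDerivAt (hf : SmoothFamilyOn f S Ω) (hS : IsOpen S) (hΩ : IsOpen Ω)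
    (ht : 0 ∈ S) (hy : y ∈ Ω) : HasDerivAt (fun s => f s y) (paramDeriv f y) 0 :=
  (hf.hasDerivAt_eq hS hΩ ht hy).differentiableAt.hasDerivAt

theorem SmoothFamilyOn.paramDeriv_eq (hf : SmoothFamilyOn f S Ω) (hS : IsOpen S) (hΩ : IsOpen Ω)
    (ht : 0 ∈ S) (hy : y ∈ Ω) :
    paramDeriv f y = fderiv ℝ (fun p : ℝ × Z => f p.1 p.2) (0, y) (1, 0) :=
  (hf.hasDerivAt_eq hS hΩ ht hy).deriv

theorem SmoothFamilyOn.contDiffOn_total_fderiv (hf : SmoothFamilyOn f S Ω) (hS : IsOpen S)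
    (hΩ : IsOpen Ω) :
    ContDiffOn ℝ ∞ (fderiv ℝ (fun p : ℝ × Z => f p.1 p.2)) (S ×ˢ Ω) :=
  ContDiffOn.fderiv_of_isOpen hf (hS.prod hΩ) (by simp)

theorem SmoothFamilyOn.fderiv (hf : SmoothFamilyOn f S Ω) (hS : IsOpen S) (hΩ : IsOpen Ω) :
    SmoothFamilyOn (fun t => fderiv ℝ (f t)) S Ω :=
  ((hf.contDiffOn_total_fderiv hS hΩ).clm_comp contDiffOn_const).congr
    fun _ hp => hf.fderiv_eq hS hΩ hp.1 hp.2

theorem SmoothFamilyOn.contDiffOn_paramDeriv (hf : SmoothFamilyOn f S Ω) (hS : IsOpen S)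
    (hΩ : IsOpen Ω) (h0 : 0 ∈ S) : ContDiffOn ℝ ∞ (paramDeriv f) Ω := by
  refine ContDiffOn.congr ?_ fun y hy => hf.paramDeriv_eq hS hΩ h0 hy
  exact ((hf.contDiffOn_total_fderiv hS hΩ).comp (contDiffOn_const.prodMk contDiffOn_id)
    fun _ h => ⟨h0, h⟩).clm_apply contDiffOn_const

/-- Differentiation in the parameter and in space commute: this is the symmetry of the second
derivative of the joint function on ℝ × Z. -/
theorem SmoothFamilyOn.paramDeriv_fderiv (hf : SmoothFamilyOn f S Ω) (hS : IsOpen S)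
    (hΩ : IsOpen Ω) (h0 : 0 ∈ S) (hy : y ∈ Ω) :
    paramDeriv (fun t => _root_.fderiv ℝ (f t)) y = _root_.fderiv ℝ (paramDeriv f) y := by
  set g := fun p : ℝ × Z => f p.1 p.2
  have hg : DifferentiableAt ℝ (_root_.fderiv ℝ g) (0, y) :=
    ((hf.contDiffOn_total_fderiv hS hΩ).contDiffAt
      ((hS.prod hΩ).mem_nhds ⟨h0, hy⟩)).differentiableAt (by simp)
  have hsymm : IsSymmSndFDerivAt ℝ g (0, y) :=
    (hf.contDiffAt hS hΩ h0 hy).isSymmSndFDerivAt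
      (by simp only [minSmoothness_of_isRCLikeNormedField]; exact WithTop.coe_le_coe.2 le_top)
  have e1 : HasDerivAt (fun t => (_root_.fderiv ℝ g (t, y)).comp (ContinuousLinearMap.inr ℝ ℝ Z))
      ((_root_.fderiv ℝ (_root_.fderiv ℝ g) (0, y) (1, 0)).comp
        (ContinuousLinearMap.inr ℝ ℝ Z)) 0 := by
    have h1 : HasDerivAt (fun t => _root_.fderiv ℝ g (t, y))
        (_root_.fderiv ℝ (_root_.fderiv ℝ g) (0, y) (1, 0)) 0 :=
      HasFDerivAt.comp_hasDerivAt (l := _root_.fderiv ℝ g) (0 : ℝ) hg.hasFDerivAt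
        ((hasDerivAt_id (0 : ℝ)).prodMk (hasDerivAt_const 0 y))
    simpa using! h1.clm_comp (hasDerivAt_const (0 : ℝ) (ContinuousLinearMap.inr ℝ ℝ Z))
  have e2 : HasFDerivAt (fun z => _root_.fderiv ℝ g (0, z) (1, 0))
      (((_root_.fderiv ℝ (_root_.fderiv ℝ g) (0, y)).comp
        (ContinuousLinearMap.inr ℝ ℝ Z)).flip (1, 0)) y := by
    have h1 : HasFDerivAt (fun z => _root_.fderiv ℝ g (0, z))
        ((_root_.fderiv ℝ (_root_.fderiv ℝ g) (0, y)).comp (ContinuousLinearMap.inr ℝ ℝ Z)) y :=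
      HasFDerivAt.comp y hg.hasFDerivAt (hasFDerivAt_prodMk_right (0 : ℝ) y)
    simpa using! h1.clm_apply (hasFDerivAt_const ((1, 0) : ℝ × Z) y)
  have e1' := e1.congr_of_eventuallyEq (f₁ := fun t => _root_.fderiv ℝ (f t) y) (by
    filter_upwards [hS.mem_nhds h0] with t ht using hf.fderiv_eq hS hΩ ht hy)
  have e2' := e2.congr_of_eventuallyEq (f₁ := paramDeriv f) (by
    filter_upwards [hΩ.mem_nhds hy] with z hz using hf.paramDeriv_eq hS hΩ h0 hz)
  rw [paramDeriv, e1'.deriv, e2'.fderiv]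
  ext v
  exact hsymm _ _

theorem SmoothFamilyOn.hasDerivAt_fderiv (hf : SmoothFamilyOn f S Ω) (hS : IsOpen S)
    (hΩ : IsOpen Ω) (h0 : 0 ∈ S) (hy : y ∈ Ω) :
    HasDerivAt (fun t => _root_.fderiv ℝ (f t) y) (_root_.fderiv ℝ (paramDeriv f) y) 0 :=
  hf.paramDeriv_fderiv hS hΩ h0 hy ▸ (hf.fderiv hS hΩ).hasDerivAt hS hΩ h0 hy

/-- In a chart, closedness is symmetry of the derivative, a linear condition, so it survives
differentiation in the parameter. -/
theorem fderiv_paramDeriv_symm {c : ℝ → Z → Z →L[ℝ] ℝ} (hS : IsOpen S) (hΩ : IsOpen Ω) (h0 : 0 ∈ S)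
    (hc : SmoothFamilyOn c S Ω) {q : Z} (hq : q ∈ Ω)
    (hclosed : ∀ t ∈ S, ∀ u v, fderiv ℝ (c t) q u v = fderiv ℝ (c t) q v u) (u v : Z) :
    fderiv ℝ (paramDeriv c) q u v = fderiv ℝ (paramDeriv c) q v u := by
  have h := hc.hasDerivAt_fderiv hS hΩ h0 hq
  have h1 : ∀ u v, HasDerivAt (fun t => fderiv ℝ (c t) q u v)
      (fderiv ℝ (paramDeriv c) q u v) 0 := fun u v => by
    simpa using! (h.clm_apply (hasDerivAt_const (0 : ℝ) u)).clm_apply (hasDerivAt_const (0 : ℝ) v)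
  refine (h1 u v).unique ((h1 v u).congr_of_eventuallyEq ?_)
  filter_upwards [hS.mem_nhds h0] with t ht using hclosed t ht u v

end Parametric

/-! ## The bracket with a horizontal one-form, in canonical coordinates -/

section Local

variable (E : Type*) [NormedAddCommGroup E] [NormedSpace ℝ E] [FiniteDimensional ℝ E]

theorem finrank_strongDual : Module.finrank ℝ (E →L[ℝ] ℝ) = Module.finrank ℝ E := by
  rw [← Subspace.dual_finrank_eq (K := ℝ) (V := E)]
  exact (LinearMap.toContinuousLinearMap (𝕜 := ℝ) (E := E) (F' := ℝ)).symm.finrank_eq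

/-- A finite-dimensional space is isomorphic to its double dual. -/
def doubleDualEquiv : E ≃L[ℝ] ((E →L[ℝ] ℝ) →L[ℝ] ℝ) :=
  (LinearEquiv.ofInjectiveOfFinrankEq
    (ContinuousLinearMap.apply ℝ ℝ : E →L[ℝ] (E →L[ℝ] ℝ) →L[ℝ] ℝ).toLinearMap
    (by
      intro x y h
      by_contra hne
      obtain ⟨p, hp⟩ := SeparatingDual.exists_ne_zero (R := ℝ) (sub_ne_zero.2 hne)
      have h' := congrArg (fun φ => φ p) h
      exact hp (by simpa [sub_eq_zero] using! h'))
    (by rw [finrank_strongDual, finrank_strongDual])).toContinuousLinearEquiv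

/-- The vector which represents an element of the double dual. -/
def ofDoubleDual : ((E →L[ℝ] ℝ) →L[ℝ] ℝ) →L[ℝ] E := (doubleDualEquiv E).symm

variable {E}

theorem apply_ofDoubleDual (φ : (E →L[ℝ] ℝ) →L[ℝ] ℝ) (p : E →L[ℝ] ℝ) :
    p (ofDoubleDual E φ) = φ p :=
  congrArg (fun ψ : (E →L[ℝ] ℝ) →L[ℝ] ℝ => ψ p) ((doubleDualEquiv E).apply_symm_apply φ)

/-- The component of a covector on `E × E*` along `E*`, as a vector of `E`. -/
def momentum : ((E × (E →L[ℝ] ℝ)) →L[ℝ] ℝ) →L[ℝ] E :=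
  (ofDoubleDual E).comp
    (ContinuousLinearMap.precomp ℝ (ContinuousLinearMap.inr ℝ E (E →L[ℝ] ℝ)))

theorem apply_momentum (φ : (E × (E →L[ℝ] ℝ)) →L[ℝ] ℝ) (p : E →L[ℝ] ℝ) :
    p (momentum φ) = φ (0, p) :=
  apply_ofDoubleDual _ p

/-- A horizontal covector vanishes on the fibre direction. Consequently the second term of
`locBracket` does not contribute to the momentum in a further bracket. -/
theorem momentum_comp_fst (α : E →L[ℝ] ℝ) :
    momentum (α.comp (ContinuousLinearMap.fst ℝ E (E →L[ℝ] ℝ))) = 0 := by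
  refine (doubleDualEquiv E).injective (ContinuousLinearMap.ext fun p => ?_)
  rw [map_zero]
  exact (apply_momentum _ p).trans (map_zero α)

/-- The bracket of `f` with the pull-back of `a`, in canonical coordinates. -/
def locBracket (a : E → E →L[ℝ] ℝ) (f : E × (E →L[ℝ] ℝ) → (E × (E →L[ℝ] ℝ)) →L[ℝ] ℝ)
    (y : E × (E →L[ℝ] ℝ)) : (E × (E →L[ℝ] ℝ)) →L[ℝ] ℝ :=
  fderiv ℝ f y (0, a y.1) +
    (fderiv ℝ a y.1 (momentum (f y))).comp (ContinuousLinearMap.fst ℝ E (E →L[ℝ] ℝ))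

/-- The pull-back of `f` by the section `c`. -/
def locPull (c : E → E →L[ℝ] ℝ) (f : E × (E →L[ℝ] ℝ) → (E × (E →L[ℝ] ℝ)) →L[ℝ] ℝ)
    (q : E) : E →L[ℝ] ℝ :=
  (f (q, c q)).comp ((ContinuousLinearMap.id ℝ E).prod (fderiv ℝ c q))

variable {Ω : Set (E × (E →L[ℝ] ℝ))} {W : Set E} {S : Set ℝ}

theorem SmoothFamilyOn.locBracket {a : ℝ → E → E →L[ℝ] ℝ}
    {f : ℝ → E × (E →L[ℝ] ℝ) → (E × (E →L[ℝ] ℝ)) →L[ℝ] ℝ}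
    (hS : IsOpen S) (hΩ : IsOpen Ω) (hW : IsOpen W) (hΩW : ∀ y ∈ Ω, y.1 ∈ W)
    (ha : SmoothFamilyOn a S W) (hf : SmoothFamilyOn f S Ω) :
    SmoothFamilyOn (fun t => _root_.locBracket (a t) (f t)) S Ω := by
  have hm : Set.MapsTo (fun p : ℝ × (E × (E →L[ℝ] ℝ)) => (p.1, p.2.1)) (S ×ˢ Ω) (S ×ˢ W) :=
    fun p hp => ⟨hp.1, hΩW _ hp.2⟩
  have hs : ContDiffOn ℝ ∞ (fun p : ℝ × (E × (E →L[ℝ] ℝ)) => (p.1, p.2.1)) (S ×ˢ Ω) :=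
    (by fun_prop : ContDiff ℝ ∞ fun p : ℝ × (E × (E →L[ℝ] ℝ)) => (p.1, p.2.1)).contDiffOn
  have h1 := ContDiffOn.comp (g := fun p : ℝ × E => a p.1 p.2) ha hs hm
  have h2 := ContDiffOn.comp (g := fun p : ℝ × E => _root_.fderiv ℝ (a p.1) p.2)
    (ha.fderiv hS hW) hs hm
  refine ContDiffOn.add ?_ ?_
  · exact ContDiffOn.clm_apply (hf.fderiv hS hΩ) (contDiffOn_const.prodMk h1)
  · refine ContDiffOn.clm_comp (ContDiffOn.clm_apply h2 ?_) contDiffOn_const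
    exact momentum.contDiff.comp_contDiffOn hf

theorem SmoothFamilyOn.locPull {c : ℝ → E → E →L[ℝ] ℝ}
    {f : ℝ → E × (E →L[ℝ] ℝ) → (E × (E →L[ℝ] ℝ)) →L[ℝ] ℝ}
    (hS : IsOpen S) (hW : IsOpen W) (hc : SmoothFamilyOn c S W)
    (hcΩ : ∀ t ∈ S, ∀ q ∈ W, (q, c t q) ∈ Ω) (hf : SmoothFamilyOn f S Ω) :
    SmoothFamilyOn (fun t => _root_.locPull (c t) (f t)) S W := by
  refine ContDiffOn.clm_comp ?_ ?_
  · exact ContDiffOn.comp (g := fun p : ℝ × (E × (E →L[ℝ] ℝ)) => f p.1 p.2) hf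
      (contDiffOn_fst.prodMk (contDiffOn_snd.prodMk hc)) fun p hp => ⟨hp.1, hcΩ _ hp.1 _ hp.2⟩
  · refine ContDiffOn.congr (f := fun p : ℝ × E => ContinuousLinearMap.inl ℝ E (E →L[ℝ] ℝ) +
      (ContinuousLinearMap.inr ℝ E (E →L[ℝ] ℝ)).comp (_root_.fderiv ℝ (c p.1) p.2)) ?_ ?_
    · exact contDiffOn_const.add (contDiffOn_const.clm_comp (hc.fderiv hS hW))
    · intro p _
      ext u <;> simp

theorem ContDiffOn.locBracket {a : E → E →L[ℝ] ℝ}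
    {f : E × (E →L[ℝ] ℝ) → (E × (E →L[ℝ] ℝ)) →L[ℝ] ℝ}
    (hΩ : IsOpen Ω) (hW : IsOpen W) (hΩW : ∀ y ∈ Ω, y.1 ∈ W)
    (ha : ContDiffOn ℝ ∞ a W) (hf : ContDiffOn ℝ ∞ f Ω) :
    ContDiffOn ℝ ∞ (_root_.locBracket a f) Ω :=
  ((smoothFamilyOn_const (S := Set.univ) ha).locBracket isOpen_univ hΩ hW hΩW
    (smoothFamilyOn_const hf)).contDiffOn (Set.mem_univ 0)

theorem ContDiffOn.locPull {c : E → E →L[ℝ] ℝ}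
    {f : E × (E →L[ℝ] ℝ) → (E × (E →L[ℝ] ℝ)) →L[ℝ] ℝ}
    (hW : IsOpen W) (hc : ContDiffOn ℝ ∞ c W) (hcΩ : ∀ q ∈ W, (q, c q) ∈ Ω)
    (hf : ContDiffOn ℝ ∞ f Ω) : ContDiffOn ℝ ∞ (_root_.locPull c f) W :=
  ((smoothFamilyOn_const (S := Set.univ) hc).locPull isOpen_univ hW (fun _ _ => hcΩ)
    (smoothFamilyOn_const hf)).contDiffOn (Set.mem_univ 0)

-- Bilinearity and commutation of the coordinate bracket

variable {a b : E → E →L[ℝ] ℝ} {f : E × (E →L[ℝ] ℝ) → (E × (E →L[ℝ] ℝ)) →L[ℝ] ℝ}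
  {y : E × (E →L[ℝ] ℝ)}

theorem locBracket_add_right {g : E × (E →L[ℝ] ℝ) → (E × (E →L[ℝ] ℝ)) →L[ℝ] ℝ}
    (hf : DifferentiableAt ℝ f y) (hg : DifferentiableAt ℝ g y) :
    locBracket a (f + g) y = locBracket a f y + locBracket a g y := by
  refine ContinuousLinearMap.ext fun v => ?_
  simp [locBracket, fderiv_add hf hg]; ring

theorem locBracket_smul_right (r : ℝ) : locBracket a (r • f) y = r • locBracket a f y := by
  refine ContinuousLinearMap.ext fun v => ?_
  simp [locBracket, fderiv_const_smul_field]

theorem locBracket_add_left (ha : DifferentiableAt ℝ a y.1) (hb : DifferentiableAt ℝ b y.1) :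
    locBracket (a + b) f y = locBracket a f y + locBracket b f y := by
  have h : ((0, a y.1 + b y.1) : E × (E →L[ℝ] ℝ)) = (0, a y.1) + (0, b y.1) := by simp
  refine ContinuousLinearMap.ext fun v => ?_
  simp [locBracket, fderiv_add ha hb, h, -Prod.mk_add_mk]; ring

theorem locBracket_smul_left (r : ℝ) : locBracket (r • a) f y = r • locBracket a f y := by
  have h : ((0, r • a y.1) : E × (E →L[ℝ] ℝ)) = r • (0, a y.1) := by simp
  refine ContinuousLinearMap.ext fun v => ?_
  simp [locBracket, fderiv_const_smul_field, h, -Prod.smul_mk]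

theorem momentum_locBracket :
    momentum (locBracket a f y) = momentum (fderiv ℝ f y (0, a y.1)) := by
  rw [locBracket, map_add, momentum_comp_fst, add_zero]

theorem fderiv_locBracket_vertical (hΩ : IsOpen Ω) (hW : IsOpen W) (hΩW : ∀ y ∈ Ω, y.1 ∈ W)
    (ha : ContDiffOn ℝ ∞ a W) (hf : ContDiffOn ℝ ∞ f Ω) (hy : y ∈ Ω) (v : E →L[ℝ] ℝ) :
    fderiv ℝ (locBracket a f) y (0, v) = fderiv ℝ (fderiv ℝ f) y (0, v) (0, a y.1) +
      (fderiv ℝ a y.1 (momentum (fderiv ℝ f y (0, v)))).comp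
        (ContinuousLinearMap.fst ℝ E (E →L[ℝ] ℝ)) := by
  have hΩy := hΩ.mem_nhds hy
  -- Along a vertical line the base point is fixed, so a and its derivative stay constant and no
  -- second derivative of a appears.
  let l : ℝ → E × (E →L[ℝ] ℝ) := fun s => (y.1, y.2 + s • v)
  have hl : HasDerivAt l (0, v) 0 := by
    have h1 : HasDerivAt (fun s : ℝ => y.2 + s • v) v 0 := by
      simpa using! ((hasDerivAt_id (0 : ℝ)).smul_const v).const_add y.2
    exact (hasDerivAt_const (0 : ℝ) y.1).prodMk h1
  have hl0 : l 0 = y := by simp [l]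
  have h0 : HasDerivAt (fun s => locBracket a f (l s)) (fderiv ℝ (locBracket a f) y (0, v)) 0 := by
    have h := ((ContDiffOn.locBracket hΩ hW hΩW ha hf).contDiffAt hΩy).differentiableAt (by simp)
    rw [← hl0] at h ⊢
    exact h.hasFDerivAt.comp_hasDerivAt (0 : ℝ) hl
  have h1 : HasDerivAt (fun s => f (l s)) (fderiv ℝ f y (0, v)) 0 := by
    have h := (hf.contDiffAt hΩy).differentiableAt (by simp)
    rw [← hl0] at h ⊢
    exact h.hasFDerivAt.comp_hasDerivAt (0 : ℝ) hl
  have h2 : HasDerivAt (fun s => fderiv ℝ f (l s)) (fderiv ℝ (fderiv ℝ f) y (0, v)) 0 := by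
    have h := ((hf.fderiv_of_isOpen (m := ∞) hΩ (by simp)).contDiffAt hΩy).differentiableAt
      (by simp)
    rw [← hl0] at h ⊢
    exact h.hasFDerivAt.comp_hasDerivAt (0 : ℝ) hl
  refine h0.unique ?_
  have h3 : HasDerivAt (fun s => fderiv ℝ f (l s) (0, a y.1))
      (fderiv ℝ (fderiv ℝ f) y (0, v) (0, a y.1)) 0 := by
    simpa using! h2.clm_apply (hasDerivAt_const (0 : ℝ) ((0, a y.1) : E × (E →L[ℝ] ℝ)))
  have h4 := (((ContinuousLinearMap.precomp ℝ
    (ContinuousLinearMap.fst ℝ E (E →L[ℝ] ℝ))).comp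
      ((fderiv ℝ a y.1).comp momentum)).hasFDerivAt (x := f (l 0))).comp_hasDerivAt (0 : ℝ) h1
  exact h3.add h4

/-- Brackets with horizontal one-forms commute. -/
theorem locBracket_comm (hΩ : IsOpen Ω) (hW : IsOpen W) (hΩW : ∀ y ∈ Ω, y.1 ∈ W)
    (ha : ContDiffOn ℝ ∞ a W) (hb : ContDiffOn ℝ ∞ b W) (hf : ContDiffOn ℝ ∞ f Ω) (hy : y ∈ Ω) :
    locBracket b (locBracket a f) y = locBracket a (locBracket b f) y := by
  have hsymm : IsSymmSndFDerivAt ℝ f y :=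
    (hf.contDiffAt (hΩ.mem_nhds hy)).isSymmSndFDerivAt
      (by simp only [minSmoothness_of_isRCLikeNormedField]; exact WithTop.coe_le_coe.2 le_top)
  -- The double bracket is the second derivative of f in the two vertical directions, symmetric by
  -- `hsymm`, plus two horizontal terms which exchanging a and b merely swaps.
  rw [locBracket, locBracket.eq_1 a (locBracket b f) y, momentum_locBracket, momentum_locBracket,
    fderiv_locBracket_vertical hΩ hW hΩW ha hf hy, fderiv_locBracket_vertical hΩ hW hΩW hb hf hy,
    hsymm.eq (0, b y.1) (0, a y.1)]
  abel

-- Differentiating brackets and pull-backs along a curve of sections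

section Variation

variable {c : ℝ → E → E →L[ℝ] ℝ} {f g : ℝ → E × (E →L[ℝ] ℝ) → (E × (E →L[ℝ] ℝ)) →L[ℝ] ℝ}

/-- The bracket is bilinear in a, f and their first derivatives, so this is the product rule
together with the exchange of parameter and space derivatives. -/
theorem paramDeriv_locBracket {a : ℝ → E → E →L[ℝ] ℝ}
    (hS : IsOpen S) (hΩ : IsOpen Ω) (hW : IsOpen W) (hΩW : ∀ y ∈ Ω, y.1 ∈ W) (h0 : 0 ∈ S)
    (ha : SmoothFamilyOn a S W) (hf : SmoothFamilyOn f S Ω) (hy : y ∈ Ω) :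
    paramDeriv (fun t => locBracket (a t) (f t)) y =
      locBracket (a 0) (paramDeriv f) y + locBracket (paramDeriv a) (f 0) y := by
  have a1 := ha.hasDerivAt hS hW h0 (hΩW y hy)
  have a2 := ha.hasDerivAt_fderiv hS hW h0 (hΩW y hy)
  have f1 := hf.hasDerivAt hS hΩ h0 hy
  have f2 := hf.hasDerivAt_fderiv hS hΩ h0 hy
  have h1 := f2.clm_apply ((hasDerivAt_const (0 : ℝ) (0 : E)).prodMk a1)
  have h2 := a2.clm_apply ((momentum (E := E)).hasFDerivAt.comp_hasDerivAt (0 : ℝ) f1)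
  have h3 := h2.clm_comp (hasDerivAt_const (0 : ℝ) (ContinuousLinearMap.fst ℝ E (E →L[ℝ] ℝ)))
  refine (h1.add h3).deriv.trans ?_
  refine ContinuousLinearMap.ext fun v => ?_
  simp [locBracket]; ring

/-- The derivative of the pull-back by a family of sections, in a closed direction. -/
theorem paramDeriv_locPull (hS : IsOpen S) (hΩ : IsOpen Ω) (hW : IsOpen W) (h0 : 0 ∈ S)
    (hc : SmoothFamilyOn c S W) (hcΩ : ∀ t ∈ S, ∀ q ∈ W, (q, c t q) ∈ Ω)
    (hf : SmoothFamilyOn f S Ω) {q : E} (hq : q ∈ W)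
    (hclosed : ∀ u v, fderiv ℝ (paramDeriv c) q u v = fderiv ℝ (paramDeriv c) q v u) :
    paramDeriv (fun t => locPull (c t) (f t)) q =
      locPull (c 0) (locBracket (paramDeriv c) (f 0) + paramDeriv f) q := by
  have hz := hcΩ 0 h0 q hq
  have c1 := hc.hasDerivAt hS hW h0 hq
  have c2 := hc.hasDerivAt_fderiv hS hW h0 hq
  have h1 := HasFDerivAt.comp_hasDerivAt_of_eq (l := fun p : ℝ × (E × (E →L[ℝ] ℝ)) => f p.1 p.2)
    (0 : ℝ) (hf.hasFDerivAt hS hΩ h0 hz)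
    ((hasDerivAt_id (0 : ℝ)).prodMk ((hasDerivAt_const (0 : ℝ) q).prodMk c1)) rfl
  have h2 : HasDerivAt (fun t => (ContinuousLinearMap.id ℝ E).prod (fderiv ℝ (c t) q))
      ((0 : E →L[ℝ] E).prod (fderiv ℝ (paramDeriv c) q)) 0 := by
    have h3 := (ContinuousLinearMap.prodMapL ℝ E E E (E →L[ℝ] ℝ)).hasFDerivAt.comp_hasDerivAt
      (0 : ℝ) ((hasDerivAt_const (0 : ℝ) (ContinuousLinearMap.id ℝ E)).prodMk c2)
    simpa using! h3.clm_comp (hasDerivAt_const (0 : ℝ)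
      ((ContinuousLinearMap.id ℝ E).prod (ContinuousLinearMap.id ℝ E)))
  refine (h1.clm_comp h2).deriv.trans ?_
  -- The curve (t, q, c t q) has a time component, which yields the parameter derivative of f, and a
  -- vertical component, which yields the first term of the bracket.
  have e1 : ((1, (0, paramDeriv c q)) : ℝ × E × (E →L[ℝ] ℝ)) =
      (1, 0) + (0, (0, paramDeriv c q)) := by simp
  rw [e1, map_add, ← hf.paramDeriv_eq hS hΩ h0 hz]
  have e2 : fderiv ℝ (fun p : ℝ × (E × (E →L[ℝ] ℝ)) => f p.1 p.2) (0, (q, c 0 q))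
      (0, (0, paramDeriv c q)) = fderiv ℝ (f 0) (q, c 0 q) (0, paramDeriv c q) := by
    rw [hf.fderiv_eq hS hΩ h0 hz]; rfl
  rw [e2]
  ext u
  simp only [locPull, locBracket, add_apply, ContinuousLinearMap.comp_apply,
    ContinuousLinearMap.prod_apply, ContinuousLinearMap.id_apply, Pi.add_apply,
    zero_apply, ContinuousLinearMap.coe_fst', Function.comp_apply, id]
  -- Differentiating Dc gives f(0, Dċ u), the pairing of Dċ u with the momentum. Closedness of ċ
  -- moves u to the other slot and turns it into the second term of the bracket.
  rw [hclosed (momentum (f 0 (q, c 0 q))) u, apply_momentum]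
  ring

/-- The operator sending f to [f, ċ] + ∂_t f is a derivation of (f, g) ↦ [f, c^*g]. The product rule
produces the derivative of c^*g, which `paramDeriv_locPull` identifies with c^* of the same operator
on g; the bracket with ċ is moved inside by `locBracket_comm`. -/
theorem variation_locBracket (hS : IsOpen S) (hΩ : IsOpen Ω) (hW : IsOpen W)
    (hΩW : ∀ y ∈ Ω, y.1 ∈ W) (h0 : 0 ∈ S)
    (hc : SmoothFamilyOn c S W) (hcΩ : ∀ t ∈ S, ∀ q ∈ W, (q, c t q) ∈ Ω)
    (hf : SmoothFamilyOn f S Ω) (hg : SmoothFamilyOn g S Ω)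
    (hclosed : ∀ q ∈ W, ∀ u v, fderiv ℝ (paramDeriv c) q u v = fderiv ℝ (paramDeriv c) q v u)
    (hy : y ∈ Ω) :
    locBracket (paramDeriv c) (locBracket (locPull (c 0) (g 0)) (f 0)) y +
        paramDeriv (fun t => locBracket (locPull (c t) (g t)) (f t)) y =
      locBracket (locPull (c 0) (g 0)) (locBracket (paramDeriv c) (f 0) + paramDeriv f) y +
        locBracket (locPull (c 0) (locBracket (paramDeriv c) (g 0) + paramDeriv g)) (f 0) y := by
  have hċ := hc.contDiffOn_paramDeriv hS hW h0
  have hf0 := hf.contDiffOn h0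
  have hΩy := hΩ.mem_nhds hy
  have hp := SmoothFamilyOn.locPull hS hW hc hcΩ hg
  have d1 : DifferentiableAt ℝ (locBracket (paramDeriv c) (f 0)) y :=
    ((ContDiffOn.locBracket hΩ hW hΩW hċ hf0).contDiffAt hΩy).differentiableAt (by simp)
  have d2 : DifferentiableAt ℝ (paramDeriv f) y :=
    ((hf.contDiffOn_paramDeriv hS hΩ h0).contDiffAt hΩy).differentiableAt (by simp)
  rw [paramDeriv_locBracket hS hΩ hW hΩW h0 hp hf hy, locBracket_add_right d1 d2,
    locBracket_comm hΩ hW hΩW (hp.contDiffOn h0) hċ hf0 hy, add_assoc]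
  congr 2
  -- The identity is needed on a neighbourhood, because the bracket also differentiates its
  -- horizontal argument.
  have heq : paramDeriv (fun t => locPull (c t) (g t)) =ᶠ[nhds y.1]
      locPull (c 0) (locBracket (paramDeriv c) (g 0) + paramDeriv g) := by
    filter_upwards [hW.mem_nhds (hΩW y hy)] with q hq using
      paramDeriv_locPull hS hΩ hW h0 hc hcΩ hg hq (hclosed q hq)
  rw [locBracket, locBracket, heq.eq_of_nhds, heq.fderiv_eq]

end Variation

end Local

/-! ## One-forms in charts -/

section Charts

open Topology Filter

variable {E : Type*} [NormedAddCommGroup E] [NormedSpace ℝ E] {H : Type*} [TopologicalSpace H]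
  {I : ModelWithCorners ℝ E H} {N : Type*} [TopologicalSpace N] [ChartedSpace H N]
  [I.Boundaryless] [IsManifold I ∞ N]
  {E' : Type*} [NormedAddCommGroup E'] [NormedSpace ℝ E'] {H' : Type*} [TopologicalSpace H']
  {I' : ModelWithCorners ℝ E' H'} {N' : Type*} [TopologicalSpace N'] [ChartedSpace H' N']
  [I'.Boundaryless] [IsManifold I' ∞ N']

theorem contMDiffAt_extChartAt_symm_of_mem {z : N} {y : E} (hy : y ∈ (extChartAt I z).target) :
    ContMDiffAt 𝓘(ℝ, E) I ∞ (extChartAt I z).symm y :=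
  (contMDiffOn_extChartAt_symm z).contMDiffAt ((isOpen_extChartAt_target z).mem_nhds hy)

theorem contMDiffAt_extChartAt_of_mem {z w : N} (hw : w ∈ (extChartAt I z).source) :
    ContMDiffAt I 𝓘(ℝ, E) ∞ (extChartAt I z) w :=
  contMDiffAt_extChartAt' (by simpa using hw)

theorem mdifferentiableAt_symm_of_mem {z : N} {y : E} (hy : y ∈ (extChartAt I z).target) :
    MDifferentiableAt 𝓘(ℝ, E) I (extChartAt I z).symm y :=
  (contMDiffAt_extChartAt_symm_of_mem hy).mdifferentiableAt (by simp)

theorem mdifferentiableAt_of_mem {z w : N} (hw : w ∈ (extChartAt I z).source) :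
    MDifferentiableAt I 𝓘(ℝ, E) (extChartAt I z) w :=
  (contMDiffAt_extChartAt_of_mem hw).mdifferentiableAt (by simp)

theorem mfderiv_symm_extChartAt_apply {z : N} {y : E} (hy : y ∈ (extChartAt I z).target)
    (v : TangentSpace I ((extChartAt I z).symm y)) :
    mfderiv 𝓘(ℝ, E) I (extChartAt I z).symm y
      (mfderiv I 𝓘(ℝ, E) (extChartAt I z) ((extChartAt I z).symm y) v) = v := by
  have : IsManifold I 1 N := IsManifold.of_le (n := ∞) (by simp)
  have h := mfderivWithin_extChartAt_symm_comp_mfderiv_extChartAt hy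
  rw [I.range_eq_univ, mfderivWithin_univ] at h
  exact congrArg (fun L : E →L[ℝ] E => L v) h

theorem chartForm_add (η θ : OneForm I N) (z : N) :
    chartForm (η + θ) z = chartForm η z + chartForm θ z := rfl

theorem chartForm_smul (r : ℝ) (η : OneForm I N) (z : N) :
    chartForm (r • η) z = r • chartForm η z := rfl

theorem eq_of_chartForm_eq {η θ : OneForm I N} {z : N} {y : E}
    (hy : y ∈ (extChartAt I z).target) (h : chartForm η z y = chartForm θ z y) :
    η ((extChartAt I z).symm y) = θ ((extChartAt I z).symm y) := by
  refine ContinuousLinearMap.ext fun v => ?_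
  have h1 := congrArg (fun L : E →L[ℝ] ℝ =>
    L (mfderiv I 𝓘(ℝ, E) (extChartAt I z) ((extChartAt I z).symm y) v)) h
  have h2 := mfderiv_symm_extChartAt_apply hy v
  simp only [chartForm] at h1
  rw [← h2]
  exact h1

theorem ext_chartForm {η θ : OneForm I N}
    (h : ∀ z, ∀ y ∈ (extChartAt I z).target, chartForm η z y = chartForm θ z y) : η = θ := by
  funext x
  have := eq_of_chartForm_eq (mem_extChartAt_target (I := I) x) (h x _ (mem_extChartAt_target x))
  rwa [extChartAt_to_inv] at this

/-- A map in charts. -/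
def chartMap (I : ModelWithCorners ℝ E H) (I' : ModelWithCorners ℝ E' H') (ψ : N → N') (z : N)
    (z' : N') : E → E' :=
  fun y => extChartAt I' z' (ψ ((extChartAt I z).symm y))

/-- Pull-back of one-forms in charts. -/
theorem chartForm_pullForm {ψ : N → N'} {η : OneForm I' N'} {z : N} {z' : N'} {y : E}
    (hy : y ∈ (extChartAt I z).target) (hψ : MDifferentiableAt I I' ψ ((extChartAt I z).symm y))
    (hy' : ψ ((extChartAt I z).symm y) ∈ (extChartAt I' z').source) :
    chartForm (pullForm I I' ψ η) z y =
      (chartForm η z' (chartMap I I' ψ z z' y)).comp (fderiv ℝ (chartMap I I' ψ z z') y) := by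
  have hs := mdifferentiableAt_symm_of_mem hy
  have h1 : MDifferentiableAt 𝓘(ℝ, E) I' (ψ ∘ (extChartAt I z).symm) y := hψ.comp y hs
  have h2 : MDifferentiableAt 𝓘(ℝ, E) 𝓘(ℝ, E') (chartMap I I' ψ z z') y :=
    (mdifferentiableAt_of_mem hy').comp y h1
  have hty : chartMap I I' ψ z z' y ∈ (extChartAt I' z').target :=
    (extChartAt I' z').map_source hy'
  have heq : (extChartAt I' z').symm ∘ chartMap I I' ψ z z' =ᶠ[𝓝 y]
      ψ ∘ (extChartAt I z).symm := by
    filter_upwards [h1.continuousAt ((isOpen_extChartAt_source z').mem_nhds hy')] with x hx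
    exact (extChartAt I' z').left_inv hx
  have e1 : mfderiv 𝓘(ℝ, E) I' (ψ ∘ (extChartAt I z).symm) y =
      (mfderiv I I' ψ ((extChartAt I z).symm y)).comp
        (mfderiv 𝓘(ℝ, E) I (extChartAt I z).symm y) := mfderiv_comp y hψ hs
  have e2 : mfderiv 𝓘(ℝ, E) I' ((extChartAt I' z').symm ∘ chartMap I I' ψ z z') y =
      (mfderiv 𝓘(ℝ, E') I' (extChartAt I' z').symm (chartMap I I' ψ z z' y)).comp
        (mfderiv 𝓘(ℝ, E) 𝓘(ℝ, E') (chartMap I I' ψ z z') y) :=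
    mfderiv_comp y (mdifferentiableAt_symm_of_mem hty) h2
  have e3 := heq.mfderiv_eq (I := 𝓘(ℝ, E)) (I' := I')
  have e4 := heq.eq_of_nhds
  -- All tangent spaces are definitionally the model space. Giving η a non-dependent type allows the
  -- base point and the derivative to be rewritten together.
  let η' : N' → E' →L[ℝ] ℝ := η
  have e5 : (η' ((ψ ∘ (extChartAt I z).symm) y)).comp
        (mfderiv 𝓘(ℝ, E) I' (ψ ∘ (extChartAt I z).symm) y : E →L[ℝ] E') =
      (η' (((extChartAt I' z').symm ∘ chartMap I I' ψ z z') y)).comp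
        (mfderiv 𝓘(ℝ, E) I' ((extChartAt I' z').symm ∘ chartMap I I' ψ z z') y : E →L[ℝ] E') :=
    congrArg₂ (fun (a : N') (L : E →L[ℝ] E') => (η' a).comp L) e4.symm e3.symm
  have e6 : chartForm (pullForm I I' ψ η) z y = (η' ((ψ ∘ (extChartAt I z).symm) y)).comp
        (mfderiv 𝓘(ℝ, E) I' (ψ ∘ (extChartAt I z).symm) y : E →L[ℝ] E') := by
    rw [e1]; rfl
  rw [e6, e5, e2, mfderiv_eq_fderiv]
  rfl

theorem pullForm_id (η : OneForm I N) : pullForm I I id η = η := by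
  funext x
  simp only [pullForm, mfderiv_id]
  rfl

theorem chartForm_change {η : OneForm I N} {z z' : N} {y : E}
    (hy : y ∈ (extChartAt I z).target)
    (hy' : (extChartAt I z).symm y ∈ (extChartAt I z').source) :
    chartForm η z y =
      (chartForm η z' (chartMap I I id z z' y)).comp (fderiv ℝ (chartMap I I id z z') y) := by
  have := chartForm_pullForm (ψ := id) (η := η) hy mdifferentiableAt_id hy'
  rwa [pullForm_id] at this

theorem contDiffAt_chartMap {ψ : N → N'} {z : N} {z' : N'} {y : E}
    (hy : y ∈ (extChartAt I z).target) (hψ : ContMDiffAt I I' ∞ ψ ((extChartAt I z).symm y))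
    (hy' : ψ ((extChartAt I z).symm y) ∈ (extChartAt I' z').source) :
    ContDiffAt ℝ ∞ (chartMap I I' ψ z z') y :=
  ((contMDiffAt_extChartAt_of_mem hy').comp y
    (hψ.comp y (contMDiffAt_extChartAt_symm_of_mem hy))).contDiffAt

theorem eventually_mem_chart {ψ : N → N'} {z : N} {z' : N'} {y : E}
    (hy : y ∈ (extChartAt I z).target) (hψ : ContinuousAt ψ ((extChartAt I z).symm y))
    (hy' : ψ ((extChartAt I z).symm y) ∈ (extChartAt I' z').source) :
    ∀ᶠ x in 𝓝 y, x ∈ (extChartAt I z).target ∧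
      ψ ((extChartAt I z).symm x) ∈ (extChartAt I' z').source := by
  have h : ContinuousAt (ψ ∘ (extChartAt I z).symm) y :=
    ContinuousAt.comp hψ (contMDiffAt_extChartAt_symm_of_mem hy).continuousAt
  filter_upwards [(isOpen_extChartAt_target z).mem_nhds hy,
    h ((isOpen_extChartAt_source z').mem_nhds hy')] with x h1 h2 using ⟨h1, h2⟩

-- Smoothness and exterior derivative in arbitrary charts

/-- Smoothness of a one-form, expressed in charts. -/
def ChartSmooth (η : OneForm I N) : Prop :=
  ∀ z, ContDiffOn ℝ ∞ (chartForm η z) (extChartAt I z).target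

theorem ChartSmooth.contDiffAt {η : OneForm I N} (h : ChartSmooth η) {z : N} {y : E}
    (hy : y ∈ (extChartAt I z).target) : ContDiffAt ℝ ∞ (chartForm η z) y :=
  (h z).contDiffAt ((isOpen_extChartAt_target z).mem_nhds hy)

theorem ChartSmooth.differentiableAt {η : OneForm I N} (h : ChartSmooth η) {z : N} {y : E}
    (hy : y ∈ (extChartAt I z).target) : DifferentiableAt ℝ (chartForm η z) y :=
  (h.contDiffAt hy).differentiableAt (by simp)

/-- Near any point of a chart domain one passes to the chart centred at that point; the transition
map and its derivative are smooth. -/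
theorem chartSmooth_of_center {η : OneForm I N}
    (h : ∀ z, ContDiffAt ℝ ∞ (chartForm η z) (extChartAt I z z)) : ChartSmooth η := by
  intro z y hy
  refine ContDiffAt.contDiffWithinAt ?_
  set x := (extChartAt I z).symm y with hx
  have hy' : id ((extChartAt I z).symm y) ∈ (extChartAt I x).source := mem_extChartAt_source x
  have hφ := contDiffAt_chartMap hy contMDiffAt_id hy'
  refine ContDiffAt.congr_of_eventuallyEq (f := fun y =>
    (chartForm η x (chartMap I I id z x y)).comp (fderiv ℝ (chartMap I I id z x) y)) ?_ ?_
  · exact (ContDiffAt.comp y (h x) hφ).clm_comp (hφ.fderiv_right (m := ∞) (by simp))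
  · filter_upwards [eventually_mem_chart hy continuousAt_id hy'] with w hw
    exact chartForm_change hw.1 hw.2

theorem inCoordinates_eq_chartForm (η : OneForm I N) {x₀ x : N}
    (hx : x ∈ (extChartAt I x₀).source) :
    ContinuousLinearMap.inCoordinates E (fun x : N => TangentSpace I x) ℝ
      (Bundle.Trivial N ℝ) x₀ x x₀ x (η x) = chartForm η x₀ (extChartAt I x₀ x) := by
  have : IsManifold I 1 N := IsManifold.of_le (n := ∞) (by simp)
  have hx' : x ∈ (chartAt H x₀).source := by simpa using hx
  have e1 := TangentBundle.symmL_trivializationAt (I := I) hx'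
  rw [I.range_eq_univ, mfderivWithin_univ] at e1
  rw [ContinuousLinearMap.inCoordinates, e1]
  have e2 := (extChartAt I x₀).left_inv hx
  let η' : N → E →L[ℝ] ℝ := η
  let T : E → E →L[ℝ] E := fun y => mfderiv 𝓘(ℝ, E) I (extChartAt I x₀).symm y
  change _ = (η' ((extChartAt I x₀).symm (extChartAt I x₀ x))).comp (T (extChartAt I x₀ x))
  rw [e2]
  ext v
  simp [η', T]
  rfl

/-- In the trivialization at x₀ a section of the cotangent bundle is its chart expression at x₀.
Bundle smoothness thus tests each chart at its centre only, which suffices. -/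
theorem isSmoothForm_iff {η : OneForm I N} : IsSmoothForm η ↔ ChartSmooth η := by
  have : IsManifold I 1 N := IsManifold.of_le (n := ∞) (by simp)
  have key : ∀ x₀ : N, (fun x => ContinuousLinearMap.inCoordinates E
      (fun x : N => TangentSpace I x) ℝ (Bundle.Trivial N ℝ) x₀ x x₀ x (η x)) =ᶠ[𝓝 x₀]
        fun x => chartForm η x₀ (extChartAt I x₀ x) := by
    intro x₀
    filter_upwards [(isOpen_extChartAt_source x₀).mem_nhds (mem_extChartAt_source (I := I) x₀)]
      with x hx using inCoordinates_eq_chartForm η hx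
  have h1 : IsSmoothForm η ↔ ∀ x, ContDiffAt ℝ ∞ (chartForm η x) (extChartAt I x x) := by
    refine forall_congr' fun x => ?_
    rw [contMDiffAt_hom_bundle]
    have h2 := (key x).contMDiffAt_iff (I := I) (I' := 𝓘(ℝ, E →L[ℝ] ℝ)) (n := ∞)
    refine Iff.trans (and_iff_right contMDiffAt_id) (h2.trans ⟨fun h => ?_, fun h => ?_⟩)
    · have hy := mem_extChartAt_target (I := I) x
      have h3 : ContMDiffAt I 𝓘(ℝ, E →L[ℝ] ℝ) ∞ (fun w => chartForm η x (extChartAt I x w))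
          ((extChartAt I x).symm (extChartAt I x x)) := by rwa [extChartAt_to_inv]
      have h4 := (h3.comp _ (contMDiffAt_extChartAt_symm_of_mem hy)).contDiffAt
      refine h4.congr_of_eventuallyEq ?_
      filter_upwards [(isOpen_extChartAt_target x).mem_nhds hy] with w hw
      simp only [Function.comp_apply, (extChartAt I x).right_inv hw]
    · exact h.contMDiffAt.comp x (contMDiffAt_extChartAt (I := I) (x := x))
  rw [h1]
  exact ⟨chartSmooth_of_center, fun h x => h.contDiffAt (mem_extChartAt_target x)⟩

/-- The exterior derivative can be computed in any chart. -/
theorem extDer_apply {η : OneForm I N} (hη : ChartSmooth η) {z : N} {y : E}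
    (hy : y ∈ (extChartAt I z).target) (p r : E) :
    extDer η ((extChartAt I z).symm y) (mfderiv 𝓘(ℝ, E) I (extChartAt I z).symm y p)
      (mfderiv 𝓘(ℝ, E) I (extChartAt I z).symm y r) =
      fderiv ℝ (chartForm η z) y p r - fderiv ℝ (chartForm η z) y r p := by
  set x := (extChartAt I z).symm y with hx
  have hy' : id ((extChartAt I z).symm y) ∈ (extChartAt I x).source := mem_extChartAt_source x
  have hφ := contDiffAt_chartMap hy contMDiffAt_id hy'
  have hφy : chartMap I I id z x y = extChartAt I x x := rfl
  have hd : ∀ v, mfderiv I 𝓘(ℝ, E) (extChartAt I x) x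
      (mfderiv 𝓘(ℝ, E) I (extChartAt I z).symm y v) = fderiv ℝ (chartMap I I id z x) y v := by
    intro v
    have := mfderiv_comp y (mdifferentiableAt_of_mem hy') (mdifferentiableAt_symm_of_mem hy)
    rw [← mfderiv_eq_fderiv]
    exact (congrArg (fun L : E →L[ℝ] E => L v) this).symm
  have heq : chartForm η z =ᶠ[𝓝 y] fun y =>
      (chartForm η x (chartMap I I id z x y)).comp (fderiv ℝ (chartMap I I id z x) y) := by
    filter_upwards [eventually_mem_chart hy continuousAt_id hy'] with w hw
    exact chartForm_change hw.1 hw.2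
  have d1 : HasFDerivAt (chartForm η x) (fderiv ℝ (chartForm η x) (extChartAt I x x))
      (chartMap I I id z x y) := (hη.differentiableAt (mem_extChartAt_target x)).hasFDerivAt
  have d2 := (hφ.differentiableAt (by simp)).hasFDerivAt
  have d3 := ((hφ.fderiv_right (m := ∞) (by simp)).differentiableAt (by simp)).hasFDerivAt
  have hsymm : IsSymmSndFDerivAt ℝ (chartMap I I id z x) y := hφ.isSymmSndFDerivAt
    (by simp only [minSmoothness_of_isRCLikeNormedField]; exact WithTop.coe_le_coe.2 le_top)
  have d4 := ((d1.comp y d2).clm_comp d3).fderiv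
  rw [heq.fderiv_eq]
  have e : ∀ p r, fderiv ℝ (fun y =>
      (chartForm η x (chartMap I I id z x y)).comp (fderiv ℝ (chartMap I I id z x) y)) y p r =
      chartForm η x (extChartAt I x x) (fderiv ℝ (fderiv ℝ (chartMap I I id z x)) y p r) +
      fderiv ℝ (chartForm η x) (extChartAt I x x) (fderiv ℝ (chartMap I I id z x) y p)
        (fderiv ℝ (chartMap I I id z x) y r) := by
    intro p r
    refine (congrArg (fun L : E →L[ℝ] E →L[ℝ] ℝ => L p r) d4).trans ?_
    simp [hφy]
  -- The second derivative of the transition map is symmetric, so its contribution drops out of the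
  -- antisymmetrized derivative.
  rw [e, e, hsymm.eq p r]
  refine (congrArg₂ (fun a b : E => fderiv ℝ (chartForm η x) (extChartAt I x x) a b -
    fderiv ℝ (chartForm η x) (extChartAt I x x) b a) (hd p) (hd r)).trans ?_
  ring

/-- `extDer` looks at each chart only at its centre; invariance under change of charts spreads
closedness over the whole chart domain. -/
theorem fderiv_chartForm_symm {η : OneForm I N} (hη : ChartSmooth η) (hc : ∀ x, extDer η x = 0)
    {z : N} {y : E} (hy : y ∈ (extChartAt I z).target) (u v : E) :
    fderiv ℝ (chartForm η z) y u v = fderiv ℝ (chartForm η z) y v u := by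
  have := extDer_apply hη hy u v
  rw [hc] at this
  exact (sub_eq_zero.1 this.symm)

theorem extDer_eq_zero {η : OneForm I N} (x : N)
    (h : ∀ u v, fderiv ℝ (chartForm η x) (extChartAt I x x) u v =
      fderiv ℝ (chartForm η x) (extChartAt I x x) v u) : extDer η x = 0 := by
  refine ContinuousLinearMap.ext fun u => ContinuousLinearMap.ext fun v => ?_
  exact sub_eq_zero.2 (h _ _)

theorem mdifferentiableAt_of_chart {g : N → ℝ} {z : N} {y : E}
    (hy : y ∈ (extChartAt I z).target)
    (hg : DifferentiableAt ℝ (fun x => g ((extChartAt I z).symm x)) y) :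
    MDifferentiableAt I 𝓘(ℝ, ℝ) g ((extChartAt I z).symm y) := by
  have hs := (extChartAt I z).map_target hy
  have hy2 := (extChartAt I z).right_inv hy
  have h1 : MDifferentiableAt 𝓘(ℝ, E) 𝓘(ℝ, ℝ) (fun x => g ((extChartAt I z).symm x))
      (extChartAt I z ((extChartAt I z).symm y)) := by
    rw [hy2]; exact hg.mdifferentiableAt
  refine (h1.comp _ (mdifferentiableAt_of_mem hs)).congr_of_eventuallyEq ?_
  filter_upwards [(isOpen_extChartAt_source z).mem_nhds hs] with w hw
  simp only [Function.comp_apply, (extChartAt I z).left_inv hw]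

theorem chartForm_dFun {g : N → ℝ} {z : N} {y : E} (hy : y ∈ (extChartAt I z).target)
    (hg : DifferentiableAt ℝ (fun x => g ((extChartAt I z).symm x)) y) :
    chartForm (dFun g : OneForm I N) z y = fderiv ℝ (fun x => g ((extChartAt I z).symm x)) y := by
  have := mfderiv_comp y (mdifferentiableAt_of_chart hy hg) (mdifferentiableAt_symm_of_mem hy)
  rw [← mfderiv_eq_fderiv]
  exact this.symm

-- Closed one-forms and local primitives

variable (I N) in
/-- Smooth closed one-forms. -/
def closedForms : Submodule ℝ (OneForm I N) where
  carrier := {η | ChartSmooth η ∧ ∀ x, extDer η x = 0}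
  zero_mem' := by
    have h : ∀ z : N, chartForm (0 : OneForm I N) z = fun _ => 0 := fun z =>
      funext fun _ => ContinuousLinearMap.zero_comp _
    refine ⟨fun z => h z ▸ contDiffOn_const, fun x => extDer_eq_zero x fun u v => ?_⟩
    rw [h]; simp
  add_mem' := by
    rintro η θ ⟨h1, h2⟩ ⟨h3, h4⟩
    refine ⟨fun z => (h1 z).add (h3 z), fun x => extDer_eq_zero x fun u v => ?_⟩
    have hx := mem_extChartAt_target (I := I) x
    rw [chartForm_add, fderiv_add (h1.differentiableAt hx) (h3.differentiableAt hx)]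
    exact congrArg₂ (· + ·) (fderiv_chartForm_symm h1 h2 hx u v)
      (fderiv_chartForm_symm h3 h4 hx u v)
  smul_mem' := by
    rintro r η ⟨h1, h2⟩
    refine ⟨fun z => (h1 z).const_smul r, fun x => extDer_eq_zero x fun u v => ?_⟩
    have hx := mem_extChartAt_target (I := I) x
    rw [chartForm_smul, fderiv_const_smul (h1.differentiableAt hx)]
    exact congrArg (r • ·) (fderiv_chartForm_symm h1 h2 hx u v)

theorem dFun_mem_closedForms {g : N → ℝ} (hg : ContMDiff I 𝓘(ℝ, ℝ) ∞ g) :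
    (dFun g : OneForm I N) ∈ closedForms I N := by
  have h1 : ∀ z : N, ContDiffOn ℝ ∞ (fun y => g ((extChartAt I z).symm y))
      (extChartAt I z).target := fun z y hy =>
    ((hg _).comp y (contMDiffAt_extChartAt_symm_of_mem hy)).contDiffAt.contDiffWithinAt
  have h2 : ∀ z : N, ∀ y ∈ (extChartAt I z).target, chartForm (dFun g : OneForm I N) z y =
      fderiv ℝ (fun y => g ((extChartAt I z).symm y)) y := fun z y hy =>
    chartForm_dFun hy (((h1 z).contDiffAt
      ((isOpen_extChartAt_target z).mem_nhds hy)).differentiableAt (by simp))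
  refine ⟨fun z => ((h1 z).fderiv_of_isOpen (isOpen_extChartAt_target z) (by simp)).congr (h2 z),
    fun x => extDer_eq_zero x fun u v => ?_⟩
  have hx := (isOpen_extChartAt_target (I := I) x).mem_nhds (mem_extChartAt_target x)
  have heq : chartForm (dFun g : OneForm I N) x =ᶠ[𝓝 (extChartAt I x x)]
      fderiv ℝ (fun y => g ((extChartAt I x).symm y)) := by
    filter_upwards [hx] with y hy using h2 x y hy
  rw [heq.fderiv_eq]
  exact (((h1 x).contDiffAt hx).isSymmSndFDerivAt
    (by simp only [minSmoothness_of_isRCLikeNormedField]; exact WithTop.coe_le_coe.2 le_top)).eq u v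

/-- A closed one-form is, near a given point, the differential of a function with compact
support. -/
theorem exists_dFun_eventuallyEq [FiniteDimensional ℝ E] [T2Space N] {β : OneForm I N}
    (hβ : β ∈ closedForms I N) (x₀ : N) :
    ∃ g : N → ℝ, ContMDiff I 𝓘(ℝ, ℝ) ∞ g ∧ HasCompactSupport g ∧
      ∀ᶠ q in 𝓝 (extChartAt I x₀ x₀), chartForm (dFun (I := I) g) x₀ q = chartForm β x₀ q := by
  obtain ⟨hβs, hβc⟩ := hβ
  have ht := mem_extChartAt_target (I := I) x₀
  obtain ⟨r, hr, hball⟩ := Metric.isOpen_iff.1 (isOpen_extChartAt_target (I := I) x₀) _ ht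
  have hs : ContDiffOn ℝ ∞ (chartForm β x₀) (Metric.ball (extChartAt I x₀ x₀) r) :=
    (hβs x₀).mono hball
  -- Poincaré lemma on a ball of the chart; the primitive is then cut off by a bump function
  -- supported over that ball.
  obtain ⟨φ, hφ⟩ :=
    (convex_ball (extChartAt I x₀ x₀) r).exists_forall_hasFDerivAt_of_fderiv_symmetric
    Metric.isOpen_ball (hs.differentiableOn (by simp))
    fun a ha u v => fderiv_chartForm_symm hβs hβc (hball ha) u v
  have hφs : ContDiffOn ℝ ∞ φ (Metric.ball (extChartAt I x₀ x₀) r) :=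
    (contDiffOn_infty_iff_fderiv_of_isOpen Metric.isOpen_ball).2
      ⟨fun a ha => (hφ a ha).differentiableAt.differentiableWithinAt,
        hs.congr fun a ha => (hφ a ha).fderiv⟩
  have hV : (extChartAt I x₀).source ∩ extChartAt I x₀ ⁻¹' Metric.ball (extChartAt I x₀ x₀) r ∈
      𝓝 x₀ := by
    refine inter_mem ((isOpen_extChartAt_source x₀).mem_nhds (mem_extChartAt_source x₀)) ?_
    exact (continuousAt_extChartAt x₀).preimage_mem_nhds (Metric.ball_mem_nhds _ hr)
  obtain ⟨χ, -, hχ⟩ := (SmoothBumpFunction.nhds_basis_tsupport (I := I) x₀).mem_iff.1 hV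
  have hsub : tsupport (fun x => χ x * φ (extChartAt I x₀ x)) ⊆ tsupport χ :=
    closure_mono fun x hx => left_ne_zero_of_mul hx
  refine ⟨fun x => χ x * φ (extChartAt I x₀ x), contMDiff_of_tsupport fun x hx => ?_,
    χ.hasCompactSupport.of_isClosed_subset (isClosed_tsupport _) hsub, ?_⟩
  · have hx' := hχ (hsub hx)
    have h1 : ContDiffAt ℝ ∞ φ (extChartAt I x₀ x) :=
      hφs.contDiffAt (Metric.isOpen_ball.mem_nhds hx'.2)
    exact χ.contMDiffAt.mul
      (h1.contMDiffAt.comp x (contMDiffAt_extChartAt_of_mem hx'.1))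
  · have h1 : ∀ᶠ q in 𝓝 (extChartAt I x₀ x₀), χ ((extChartAt I x₀).symm q) = 1 := by
      have hc := (contMDiffAt_extChartAt_symm_of_mem ht).continuousAt
      rw [ContinuousAt, extChartAt_to_inv] at hc
      exact hc.eventually χ.eventuallyEq_one
    -- The bump function must equal 1 near q, not only at q, for its derivative not to contribute.
    filter_upwards [h1.eventually_nhds, (isOpen_extChartAt_target x₀).eventually_mem ht,
      Metric.isOpen_ball.eventually_mem (Metric.mem_ball_self hr)] with q hq hqt hqb
    have heq : (fun y => χ ((extChartAt I x₀).symm y) *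
        φ (extChartAt I x₀ ((extChartAt I x₀).symm y))) =ᶠ[𝓝 q] φ := by
      filter_upwards [hq, (isOpen_extChartAt_target x₀).eventually_mem hqt] with y hy hyt
      rw [hy, one_mul, (extChartAt I x₀).right_inv hyt]
    have hd := (hφ q hqb).congr_of_eventuallyEq heq
    rw [chartForm_dFun hqt hd.differentiableAt, hd.fderiv]

end Charts

/-! ## The cotangent bundle in charts -/

section CotangentCharts

open Topology Filter

theorem locBracket_congr {E : Type*} [NormedAddCommGroup E] [NormedSpace ℝ E]
    [FiniteDimensional ℝ E] {a b : E → E →L[ℝ] ℝ}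
    {f g : E × (E →L[ℝ] ℝ) → (E × (E →L[ℝ] ℝ)) →L[ℝ] ℝ} {y : E × (E →L[ℝ] ℝ)}
    (ha : a =ᶠ[𝓝 y.1] b) (hf : f =ᶠ[𝓝 y] g) : locBracket a f y = locBracket b g y := by
  rw [locBracket, locBracket, ha.eq_of_nhds, hf.eq_of_nhds, ha.fderiv_eq, hf.fderiv_eq]

variable {E : Type*} [NormedAddCommGroup E] [NormedSpace ℝ E]
  {M : Type*} [TopologicalSpace M] [ChartedSpace E M] [IsManifold 𝓘(ℝ, E) ∞ M]
  {G : TopologicalSpace.Opens (CotangentBundle E M)}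

theorem cot_mem_source {z w : G} : w ∈ (extChartAt (cotModel E) z).source ↔
    cotProj G w ∈ (extChartAt 𝓘(ℝ, E) (cotProj G z)).source := by
  have e : chartAt (ModelProd E (E →L[ℝ] ℝ)) z =
    (chartAt (ModelProd E (E →L[ℝ] ℝ)) z.1).subtypeRestr ⟨z⟩ := rfl
  rw [extChartAt_source, extChartAt_source, e, OpenPartialHomeomorph.subtypeRestr_source,
    Set.mem_preimage, FiberBundle.chartedSpace_chartAt]
  simp only [cotProj, mfld_simps]
  exact ⟨fun h => h.1.1, fun h => ⟨⟨h, Set.mem_univ _⟩, h⟩⟩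

/-- The charts of G are canonical coordinates (q, p): p is the covector pulled back by the inverse
chart of the base. -/
theorem cot_extChartAt_apply {z w : G} (hw : w ∈ (extChartAt (cotModel E) z).source) :
    extChartAt (cotModel E) z w =
      (extChartAt 𝓘(ℝ, E) (cotProj G z) (cotProj G w),
        (w.1.snd : E →L[ℝ] ℝ).comp (mfderiv 𝓘(ℝ, E) 𝓘(ℝ, E)
          (extChartAt 𝓘(ℝ, E) (cotProj G z)).symm
          (extChartAt 𝓘(ℝ, E) (cotProj G z) (cotProj G w)) : E →L[ℝ] E)) := by
  have : IsManifold 𝓘(ℝ, E) 1 M := IsManifold.of_le (n := ∞) (by simp)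
  have hx : cotProj G w ∈ (chartAt E (cotProj G z)).source := by
    simpa using cot_mem_source.1 hw
  have e1 := TangentBundle.symmL_trivializationAt (I := 𝓘(ℝ, E)) hx
  rw [ModelWithCorners.range_eq_univ, mfderivWithin_univ] at e1
  have e2 : extChartAt (cotModel E) z w = chartAt (ModelProd E (E →L[ℝ] ℝ)) z.1 w.1 := rfl
  rw [e2, hom_chart]
  refine Prod.ext rfl ?_
  rw [ContinuousLinearMap.inCoordinates]
  change _ ∘SL (w.1.snd ∘SL (trivializationAt E (TangentSpace 𝓘(ℝ, E)) (cotProj G z)).symmL ℝ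
    (cotProj G w)) = _
  rw [e1]
  ext v
  simp
  rfl

theorem contMDiff_cotProj : ContMDiff (cotModel E) 𝓘(ℝ, E) ∞ (cotProj G) :=
  (Bundle.contMDiff_proj _).comp contMDiff_subtype_val

theorem cot_target {z : G} {y : E × (E →L[ℝ] ℝ)} (hy : y ∈ (extChartAt (cotModel E) z).target) :
    cotProj G ((extChartAt (cotModel E) z).symm y) ∈
      (extChartAt 𝓘(ℝ, E) (cotProj G z)).source :=
  cot_mem_source.1 ((extChartAt (cotModel E) z).map_target hy)

theorem cot_extChartAt_symm {z : G} {y : E × (E →L[ℝ] ℝ)}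
    (hy : y ∈ (extChartAt (cotModel E) z).target) :
    extChartAt 𝓘(ℝ, E) (cotProj G z) (cotProj G ((extChartAt (cotModel E) z).symm y)) = y.1 ∧
    (((extChartAt (cotModel E) z).symm y).1.snd : E →L[ℝ] ℝ).comp
      (mfderiv 𝓘(ℝ, E) 𝓘(ℝ, E) (extChartAt 𝓘(ℝ, E) (cotProj G z)).symm y.1 : E →L[ℝ] E) = y.2 := by
  have h := cot_extChartAt_apply ((extChartAt (cotModel E) z).map_target hy)
  rw [(extChartAt (cotModel E) z).right_inv hy] at h
  have h1 := congrArg Prod.fst h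
  have h2 := congrArg Prod.snd h
  refine ⟨h1.symm, ?_⟩
  simp only at h1 h2
  rw [← h1] at h2
  exact h2.symm

theorem cot_fst_mem {z : G} {y : E × (E →L[ℝ] ℝ)}
    (hy : y ∈ (extChartAt (cotModel E) z).target) :
    y.1 ∈ (extChartAt 𝓘(ℝ, E) (cotProj G z)).target := by
  rw [← (cot_extChartAt_symm hy).1]
  exact (extChartAt 𝓘(ℝ, E) (cotProj G z)).map_source (cot_target hy)

/-- The horizontal one-form `τ^* a`. -/
abbrev horForm (G : TopologicalSpace.Opens (CotangentBundle E M)) (a : OneForm 𝓘(ℝ, E) M) :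
    OneForm (cotModel E) G :=
  pullForm (cotModel E) 𝓘(ℝ, E) (cotProj G) a

theorem chartForm_horForm (a : OneForm 𝓘(ℝ, E) M) {z : G} {y : E × (E →L[ℝ] ℝ)}
    (hy : y ∈ (extChartAt (cotModel E) z).target) :
    chartForm (horForm G a) z y =
      (chartForm a (cotProj G z) y.1).comp (ContinuousLinearMap.fst ℝ E (E →L[ℝ] ℝ)) := by
  have heq : chartMap (cotModel E) 𝓘(ℝ, E) (cotProj G) z (cotProj G z) =ᶠ[𝓝 y] Prod.fst := by
    filter_upwards [(isOpen_extChartAt_target z).mem_nhds hy] with w hw using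
      (cot_extChartAt_symm hw).1
  rw [chartForm_pullForm hy (contMDiff_cotProj.mdifferentiableAt (by simp)) (cot_target hy),
    heq.fderiv_eq, heq.eq_of_nhds, fderiv_fst]

theorem ChartSmooth.hor {a : OneForm 𝓘(ℝ, E) M} (ha : ChartSmooth a) :
    ChartSmooth (horForm G a) := fun z => by
  refine ContDiffOn.congr ?_ fun y hy => chartForm_horForm a hy
  exact ((ha (cotProj G z)).comp contDiffOn_fst fun y hy => cot_fst_mem hy).clm_comp
    contDiffOn_const

theorem chartForm_liouville {z : G} {y : E × (E →L[ℝ] ℝ)}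
    (hy : y ∈ (extChartAt (cotModel E) z).target) :
    chartForm (liouville G) z y = y.2.comp (ContinuousLinearMap.fst ℝ E (E →L[ℝ] ℝ)) := by
  let p : E →L[ℝ] ℝ := ((extChartAt (cotModel E) z).symm y).1.snd
  -- At one point p dq coincides with τ^*a for any a taking the value p there. The chart expression
  -- is pointwise, so regularity of a plays no role.
  let a : OneForm 𝓘(ℝ, E) M := fun _ => p
  have h : chartForm (liouville G) z y = chartForm (horForm G a) z y := rfl
  rw [h, chartForm_horForm a hy]
  exact congrArg (fun q : E →L[ℝ] ℝ => q.comp (ContinuousLinearMap.fst ℝ E (E →L[ℝ] ℝ)))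
    (cot_extChartAt_symm hy).2

theorem chartSmooth_liouville : ChartSmooth (liouville G) := fun z => by
  refine ContDiffOn.congr ?_ fun y hy => chartForm_liouville hy
  exact contDiffOn_snd.clm_comp contDiffOn_const

/-- The symplectic form is canonical in charts. -/
theorem omega_apply {z : G} {y : E × (E →L[ℝ] ℝ)}
    (hy : y ∈ (extChartAt (cotModel E) z).target) (p r : E × (E →L[ℝ] ℝ)) :
    omega G ((extChartAt (cotModel E) z).symm y)
      (mfderiv 𝓘(ℝ, E × (E →L[ℝ] ℝ)) (cotModel E) (extChartAt (cotModel E) z).symm y p)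
      (mfderiv 𝓘(ℝ, E × (E →L[ℝ] ℝ)) (cotModel E) (extChartAt (cotModel E) z).symm y r) =
      p.2 r.1 - r.2 p.1 := by
  have heq : chartForm (liouville G) z =ᶠ[𝓝 y]
      fun y => y.2.comp (ContinuousLinearMap.fst ℝ E (E →L[ℝ] ℝ)) := by
    filter_upwards [(isOpen_extChartAt_target z).mem_nhds hy] with w hw using
      chartForm_liouville hw
  have hd := ((ContinuousLinearMap.precomp ℝ (ContinuousLinearMap.fst ℝ E (E →L[ℝ] ℝ))).comp
    (ContinuousLinearMap.snd ℝ E (E →L[ℝ] ℝ))).hasFDerivAt (x := y)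
  have hd' := (hd.congr_of_eventuallyEq heq).fderiv
  have h := extDer_apply (chartSmooth_liouville (G := G)) hy p r
  rw [hd'] at h
  exact h

theorem exists_chart_vector {z : G} {y : E × (E →L[ℝ] ℝ)}
    (hy : y ∈ (extChartAt (cotModel E) z).target)
    (v : TangentSpace (cotModel E) ((extChartAt (cotModel E) z).symm y)) :
    ∃ p : E × (E →L[ℝ] ℝ),
      mfderiv 𝓘(ℝ, E × (E →L[ℝ] ℝ)) (cotModel E) (extChartAt (cotModel E) z).symm y p = v :=
  ⟨_, mfderiv_symm_extChartAt_apply hy v⟩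

theorem exists_chart_point (w : G) : ∃ (z : G) (y : E × (E →L[ℝ] ℝ)),
    y ∈ (extChartAt (cotModel E) z).target ∧ (extChartAt (cotModel E) z).symm y = w :=
  ⟨w, _, mem_extChartAt_target w, extChartAt_to_inv w⟩

theorem omega_antisymm (w : G) (u v : TangentSpace (cotModel E) w) :
    omega G w u v = - omega G w v u := by
  obtain ⟨z, y, hy, rfl⟩ := exists_chart_point w
  obtain ⟨p, rfl⟩ := exists_chart_vector hy u
  obtain ⟨r, rfl⟩ := exists_chart_vector hy v
  refine (omega_apply hy p r).trans (Eq.trans ?_ (congrArg Neg.neg (omega_apply hy r p).symm))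
  ring

-- Hamiltonian vector fields and the bracket in canonical coordinates

variable [FiniteDimensional ℝ E]

/-- The canonical form is nondegenerate and the dimensions agree. Without this, `inverse` in `sharp`
would take its default value 0. -/
theorem omega_isInvertible (w : G) : (omega G w).IsInvertible := by
  let L : (E × (E →L[ℝ] ℝ)) →L[ℝ] (E × (E →L[ℝ] ℝ)) →L[ℝ] ℝ := omega G w
  have hinj : Function.Injective L.toLinearMap := by
    obtain ⟨z, y, hy, rfl⟩ := exists_chart_point w
    refine (injective_iff_map_eq_zero _).2 fun u hu => ?_
    obtain ⟨p, rfl⟩ := exists_chart_vector hy u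
    have h : ∀ r : E × (E →L[ℝ] ℝ), p.2 r.1 - r.2 p.1 = 0 := fun r =>
      (omega_apply hy p r).symm.trans (congrArg (fun φ : (E × (E →L[ℝ] ℝ)) →L[ℝ] ℝ =>
        φ (mfderiv 𝓘(ℝ, E × (E →L[ℝ] ℝ)) (cotModel E) (extChartAt (cotModel E) z).symm y r)) hu)
    have h1 : p.1 = 0 := by
      by_contra hne
      obtain ⟨q, hq⟩ := SeparatingDual.exists_ne_zero (R := ℝ) hne
      exact hq (by simpa using h (0, q))
    have h2 : p.2 = 0 := ContinuousLinearMap.ext fun e => by simpa using h (e, 0)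
    have hp : p = 0 := Prod.ext h1 h2
    rw [hp]
    exact map_zero _
  let e := (LinearEquiv.ofInjectiveOfFinrankEq L.toLinearMap hinj
    (finrank_strongDual _).symm).toContinuousLinearEquiv
  exact ⟨e, ContinuousLinearMap.ext fun u => rfl⟩

/-- These are Hamilton's equations: with ω = dp ∧ dq, the condition ω(X, ·) = -η gives X the fibre
part of η as base component and minus its base part as fibre component. -/
theorem sharp_apply (η : OneForm (cotModel E) G) {z : G} {y : E × (E →L[ℝ] ℝ)}
    (hy : y ∈ (extChartAt (cotModel E) z).target) :
    sharp G η ((extChartAt (cotModel E) z).symm y) =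
      mfderiv 𝓘(ℝ, E × (E →L[ℝ] ℝ)) (cotModel E) (extChartAt (cotModel E) z).symm y
        (momentum (chartForm η z y),
          -(chartForm η z y).comp (ContinuousLinearMap.inl ℝ E (E →L[ℝ] ℝ))) := by
  refine ((omega_isInvertible _).inverse_apply_eq).2 (ContinuousLinearMap.ext fun u => ?_)
  obtain ⟨r, rfl⟩ := exists_chart_vector hy u
  refine Eq.trans ?_ (omega_apply hy _ r).symm
  have h : chartForm η z y r = chartForm η z y (r.1, 0) + chartForm η z y (0, r.2) := by
    rw [← map_add]; simp
  change - chartForm η z y r = _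
  rw [h, apply_momentum]
  simp
  ring

theorem omega_sharp (η : OneForm (cotModel E) G) (w : G) (u : TangentSpace (cotModel E) w) :
    omega G w (sharp G η w) u = - η w u := by
  have h : omega G w (sharp G η w) = - η w :=
    (((omega_isInvertible w).inverse_apply_eq (x := sharp G η w) (y := -(η w))).1 rfl).symm
  rw [h]; rfl

theorem sharp_horForm (a : OneForm 𝓘(ℝ, E) M) {z : G} {y : E × (E →L[ℝ] ℝ)}
    (hy : y ∈ (extChartAt (cotModel E) z).target) :
    sharp G (horForm G a) ((extChartAt (cotModel E) z).symm y) =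
      mfderiv 𝓘(ℝ, E × (E →L[ℝ] ℝ)) (cotModel E) (extChartAt (cotModel E) z).symm y
        (0, -(chartForm a (cotProj G z) y.1)) := by
  rw [sharp_apply _ hy, chartForm_horForm a hy, momentum_comp_fst]
  congr 2

theorem hasFDerivAt_chartForm_horForm {a : OneForm 𝓘(ℝ, E) M} (ha : ChartSmooth a) {z : G}
    {y : E × (E →L[ℝ] ℝ)} (hy : y ∈ (extChartAt (cotModel E) z).target) :
    HasFDerivAt (chartForm (horForm G a) z)
      ((ContinuousLinearMap.precomp ℝ (ContinuousLinearMap.fst ℝ E (E →L[ℝ] ℝ))).comp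
        ((fderiv ℝ (chartForm a (cotProj G z)) y.1).comp
          (ContinuousLinearMap.fst ℝ E (E →L[ℝ] ℝ)))) y := by
  have da := (ha.differentiableAt (cot_fst_mem hy)).hasFDerivAt
  refine ((ContinuousLinearMap.precomp ℝ
    (ContinuousLinearMap.fst ℝ E (E →L[ℝ] ℝ))).hasFDerivAt.comp y
      (da.comp y hasFDerivAt_fst)).congr_of_eventuallyEq ?_
  filter_upwards [(isOpen_extChartAt_target z).mem_nhds hy] with w hw using chartForm_horForm a hw

theorem hasFDerivAt_apply_sharp_horForm {η : OneForm (cotModel E) G} {a : OneForm 𝓘(ℝ, E) M}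
    (hη : ChartSmooth η) (ha : ChartSmooth a) {z : G} {y : E × (E →L[ℝ] ℝ)}
    (hy : y ∈ (extChartAt (cotModel E) z).target) :
    HasFDerivAt (fun x => η ((extChartAt (cotModel E) z).symm x)
      (sharp G (horForm G a) ((extChartAt (cotModel E) z).symm x)))
      ((chartForm η z y).comp ((0 : (E × (E →L[ℝ] ℝ)) →L[ℝ] E).prod
        (-((fderiv ℝ (chartForm a (cotProj G z)) y.1).comp
          (ContinuousLinearMap.fst ℝ E (E →L[ℝ] ℝ))))) +
        (fderiv ℝ (chartForm η z) y).flip (0, -(chartForm a (cotProj G z) y.1))) y := by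
  have da := (ha.differentiableAt (cot_fst_mem hy)).hasFDerivAt
  have h1 : HasFDerivAt (fun x : E × (E →L[ℝ] ℝ) => ((0 : E), -(chartForm a (cotProj G z) x.1)))
      ((0 : (E × (E →L[ℝ] ℝ)) →L[ℝ] E).prod
        (-((fderiv ℝ (chartForm a (cotProj G z)) y.1).comp
          (ContinuousLinearMap.fst ℝ E (E →L[ℝ] ℝ))))) y :=
    (hasFDerivAt_const (0 : E) y).prodMk (da.comp y hasFDerivAt_fst).neg
  refine ((hη.differentiableAt hy).hasFDerivAt.clm_apply h1).congr_of_eventuallyEq ?_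
  filter_upwards [(isOpen_extChartAt_target z).mem_nhds hy] with w hw
  rw [sharp_horForm a hw]
  rfl

/-- Since ω(X_η, X_a) = a(X_η), the exact part of the Lie derivative along X_η cancels against the
last term of the bracket, and X_η itself never has to be differentiated. -/
theorem formBracket_horForm_eq (η : OneForm (cotModel E) G) (a : OneForm 𝓘(ℝ, E) M) (w : G) :
    formBracket G η (horForm G a) w = extDer (horForm G a) w (sharp G η w) -
      extDer η w (sharp G (horForm G a) w) - dFun (fun w => η w (sharp G (horForm G a) w)) w := by
  have hfun : (fun w : G => omega G w (sharp G η w) (sharp G (horForm G a) w)) =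
      fun w => horForm G a w (sharp G η w) := by
    funext w
    rw [omega_antisymm, omega_sharp, neg_neg]
  have e : formBracket G η (horForm G a) w =
    extDer (horForm G a) w (sharp G η w) + dFun (fun w => horForm G a w (sharp G η w)) w -
      (extDer η w (sharp G (horForm G a) w) + dFun (fun w => η w (sharp G (horForm G a) w)) w) -
      dFun (fun w => omega G w (sharp G η w) (sharp G (horForm G a) w)) w := rfl
  rw [e, hfun]
  abel

/-- The bracket with a horizontal one-form in charts. -/
theorem chartForm_formBracket {η : OneForm (cotModel E) G} {a : OneForm 𝓘(ℝ, E) M}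
    (hη : ChartSmooth η) (ha : ChartSmooth a) {z : G} {y : E × (E →L[ℝ] ℝ)}
    (hy : y ∈ (extChartAt (cotModel E) z).target) :
    chartForm (formBracket G η (horForm G a)) z y =
      locBracket (chartForm a (cotProj G z)) (chartForm η z) y := by
  have hg := hasFDerivAt_apply_sharp_horForm hη ha hy
  have hgd := (chartForm_dFun (g := fun w => η w (sharp G (horForm G a) w)) hy
    hg.differentiableAt).trans hg.fderiv
  have hα := (hasFDerivAt_chartForm_horForm ha hy).fderiv
  refine ContinuousLinearMap.ext fun v => ?_
  have e0 : chartForm (formBracket G η (horForm G a)) z y v =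
      extDer (horForm G a) ((extChartAt (cotModel E) z).symm y)
        (sharp G η ((extChartAt (cotModel E) z).symm y))
        (mfderiv 𝓘(ℝ, E × (E →L[ℝ] ℝ)) (cotModel E) (extChartAt (cotModel E) z).symm y v) -
      extDer η ((extChartAt (cotModel E) z).symm y)
        (sharp G (horForm G a) ((extChartAt (cotModel E) z).symm y))
        (mfderiv 𝓘(ℝ, E × (E →L[ℝ] ℝ)) (cotModel E) (extChartAt (cotModel E) z).symm y v) -
      chartForm (dFun (I := cotModel E) fun w => η w (sharp G (horForm G a) w)) z y v := by
    have h := formBracket_horForm_eq η a ((extChartAt (cotModel E) z).symm y)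
    rw [chartForm, h]
    rfl
  have e1 : extDer (horForm G a) ((extChartAt (cotModel E) z).symm y)
        (sharp G η ((extChartAt (cotModel E) z).symm y))
        (mfderiv 𝓘(ℝ, E × (E →L[ℝ] ℝ)) (cotModel E) (extChartAt (cotModel E) z).symm y v) =
      fderiv ℝ (chartForm a (cotProj G z)) y.1 (momentum (chartForm η z y)) v.1 -
        fderiv ℝ (chartForm a (cotProj G z)) y.1 v.1 (momentum (chartForm η z y)) := by
    rw [sharp_apply η hy]
    refine (extDer_apply ha.hor hy _ v).trans ?_
    rw [hα]
    rfl
  have e2 : extDer η ((extChartAt (cotModel E) z).symm y)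
        (sharp G (horForm G a) ((extChartAt (cotModel E) z).symm y))
        (mfderiv 𝓘(ℝ, E × (E →L[ℝ] ℝ)) (cotModel E) (extChartAt (cotModel E) z).symm y v) =
      fderiv ℝ (chartForm η z) y (0, -(chartForm a (cotProj G z) y.1)) v -
        fderiv ℝ (chartForm η z) y v (0, -(chartForm a (cotProj G z) y.1)) := by
    rw [sharp_horForm a hy]
    exact extDer_apply hη hy _ v
  have e3 : chartForm (dFun (I := cotModel E) fun w => η w (sharp G (horForm G a) w)) z y v =
      chartForm η z y (0, -(fderiv ℝ (chartForm a (cotProj G z)) y.1 v.1)) +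
        fderiv ℝ (chartForm η z) y v (0, -(chartForm a (cotProj G z) y.1)) :=
    congrArg (fun L : (E × (E →L[ℝ] ℝ)) →L[ℝ] ℝ => L v) hgd
  have e4 : ∀ p : E →L[ℝ] ℝ, ((0, -p) : E × (E →L[ℝ] ℝ)) = -(0, p) := fun p => by simp
  have e5 : locBracket (chartForm a (cotProj G z)) (chartForm η z) y v =
      fderiv ℝ (chartForm η z) y (0, chartForm a (cotProj G z) y.1) v +
      fderiv ℝ (chartForm a (cotProj G z)) y.1 (momentum (chartForm η z y)) v.1 := rfl
  -- The term η(0, Da v), a derivative of X_a, cancels the transposed half of da, while the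
  -- transposed derivatives of η cancel each other. This is why a need not be closed.
  rw [e0, e1, e2, e3, e5, e4, e4, map_neg, map_neg, map_neg, apply_momentum]
  simp only [neg_apply]
  ring

theorem ChartSmooth.bracket {η : OneForm (cotModel E) G} {a : OneForm 𝓘(ℝ, E) M}
    (hη : ChartSmooth η) (ha : ChartSmooth a) : ChartSmooth (formBracket G η (horForm G a)) :=
  fun z => (ContDiffOn.locBracket (isOpen_extChartAt_target z) (isOpen_extChartAt_target _)
    (fun _ hy => cot_fst_mem hy) (ha _) (hη z)).congr fun _ hy => chartForm_formBracket hη ha hy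

theorem formBracket_horForm_comm {η : OneForm (cotModel E) G} {a b : OneForm 𝓘(ℝ, E) M}
    (hη : ChartSmooth η) (ha : ChartSmooth a) (hb : ChartSmooth b) :
    formBracket G (formBracket G η (horForm G a)) (horForm G b) =
      formBracket G (formBracket G η (horForm G b)) (horForm G a) := by
  have key : ∀ {a b : OneForm 𝓘(ℝ, E) M}, ChartSmooth a → ChartSmooth b → ∀ (z : G),
      ∀ y ∈ (extChartAt (cotModel E) z).target,
      chartForm (formBracket G (formBracket G η (horForm G a)) (horForm G b)) z y =
      locBracket (chartForm b (cotProj G z))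
        (locBracket (chartForm a (cotProj G z)) (chartForm η z)) y := by
    intro a b ha hb z y hy
    rw [chartForm_formBracket (hη.bracket ha) hb hy]
    refine locBracket_congr EventuallyEq.rfl ?_
    filter_upwards [(isOpen_extChartAt_target z).mem_nhds hy] with w hw using
      chartForm_formBracket hη ha hw
  refine ext_chartForm fun z y hy => ?_
  rw [key ha hb z y hy, key hb ha z y hy]
  exact locBracket_comm (isOpen_extChartAt_target z) (isOpen_extChartAt_target _)
    (fun _ hy => cot_fst_mem hy) (ha _) (hb _) (hη z) hy

end CotangentCharts

/-! ## Closed sections in charts -/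

section Sections

open Topology Filter

variable {E : Type*} [NormedAddCommGroup E] [NormedSpace ℝ E]
  {M : Type*} [TopologicalSpace M] [ChartedSpace E M] [IsManifold 𝓘(ℝ, E) ∞ M]
  {G : TopologicalSpace.Opens (CotangentBundle E M)}

namespace ClosedSection

variable (ζ : ClosedSection G)

theorem chartSmooth : ChartSmooth ζ.toForm := isSmoothForm_iff.1 ζ.smooth

/-- The one-form `ζ` in the chart of `M` which underlies the chart of `G` at `z`. -/
abbrev inChart (z : G) : E → E →L[ℝ] ℝ := chartForm ζ.toForm (cotProj G z)

theorem inChart_contDiffOn (z : G) :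
    ContDiffOn ℝ ∞ (ζ.inChart z) (extChartAt 𝓘(ℝ, E) (cotProj G z)).target :=
  ζ.chartSmooth _

theorem toMap_mem_source {z : G} {q : E} (hq : q ∈ (extChartAt 𝓘(ℝ, E) (cotProj G z)).target) :
    ζ.toMap ((extChartAt 𝓘(ℝ, E) (cotProj G z)).symm q) ∈ (extChartAt (cotModel E) z).source :=
  cot_mem_source.2 ((extChartAt 𝓘(ℝ, E) (cotProj G z)).map_target hq)

theorem chartMap_toMap {z : G} {q : E} (hq : q ∈ (extChartAt 𝓘(ℝ, E) (cotProj G z)).target) :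
    chartMap 𝓘(ℝ, E) (cotModel E) ζ.toMap (cotProj G z) z q = (q, ζ.inChart z q) := by
  have h := cot_extChartAt_apply (ζ.toMap_mem_source hq)
  have e : extChartAt 𝓘(ℝ, E) (cotProj G z)
      (cotProj G (ζ.toMap ((extChartAt 𝓘(ℝ, E) (cotProj G z)).symm q))) = q :=
    (extChartAt 𝓘(ℝ, E) (cotProj G z)).right_inv hq
  rw [e] at h
  exact h

theorem mem_target {z : G} {q : E} (hq : q ∈ (extChartAt 𝓘(ℝ, E) (cotProj G z)).target) :
    (q, ζ.inChart z q) ∈ (extChartAt (cotModel E) z).target := by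
  rw [← ζ.chartMap_toMap hq]
  exact (extChartAt (cotModel E) z).map_source (ζ.toMap_mem_source hq)

/-- In the charts the map is the graph q ↦ (q, ζ q), so it is differentiable because the
coefficients of ζ are. -/
theorem mdifferentiableAt_toMap (z : G) {q : E}
    (hq : q ∈ (extChartAt 𝓘(ℝ, E) (cotProj G z)).target) :
    MDifferentiableAt 𝓘(ℝ, E) (cotModel E) ζ.toMap
      ((extChartAt 𝓘(ℝ, E) (cotProj G z)).symm q) := by
  have hs := (extChartAt 𝓘(ℝ, E) (cotProj G z)).map_target hq
  have hr := (extChartAt 𝓘(ℝ, E) (cotProj G z)).right_inv hq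
  have d1 : MDifferentiableAt 𝓘(ℝ, E) 𝓘(ℝ, E × (E →L[ℝ] ℝ)) (fun q => (q, ζ.inChart z q))
      (extChartAt 𝓘(ℝ, E) (cotProj G z) ((extChartAt 𝓘(ℝ, E) (cotProj G z)).symm q)) := by
    rw [hr]
    exact (differentiableAt_id.prodMk (ζ.chartSmooth.differentiableAt hq)).mdifferentiableAt
  have d2 := d1.comp _ (mdifferentiableAt_of_mem hs)
  have d3 : MDifferentiableAt 𝓘(ℝ, E × (E →L[ℝ] ℝ)) (cotModel E) (extChartAt (cotModel E) z).symm
      (((fun q => (q, ζ.inChart z q)) ∘ extChartAt 𝓘(ℝ, E) (cotProj G z))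
        ((extChartAt 𝓘(ℝ, E) (cotProj G z)).symm q)) := by
    refine mdifferentiableAt_symm_of_mem ?_
    rw [Function.comp_apply, hr]
    exact ζ.mem_target hq
  refine (d3.comp _ d2).congr_of_eventuallyEq ?_
  filter_upwards [(isOpen_extChartAt_source (cotProj G z)).mem_nhds hs] with x hx
  have hx1 := (extChartAt 𝓘(ℝ, E) (cotProj G z)).map_source hx
  have hx2 := (extChartAt 𝓘(ℝ, E) (cotProj G z)).left_inv hx
  have hx3 := ζ.chartMap_toMap hx1
  rw [Function.comp_apply, Function.comp_apply, ← hx3, chartMap, hx2]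
  refine ((extChartAt (cotModel E) z).left_inv ?_).symm
  have := ζ.toMap_mem_source hx1
  rwa [hx2] at this

/-- Pull-back by a closed section in charts. -/
theorem chartForm_pull (η : OneForm (cotModel E) G) {z : G} {q : E}
    (hq : q ∈ (extChartAt 𝓘(ℝ, E) (cotProj G z)).target) :
    chartForm (ζ.pull η) (cotProj G z) q = locPull (ζ.inChart z) (chartForm η z) q := by
  have heq : chartMap 𝓘(ℝ, E) (cotModel E) ζ.toMap (cotProj G z) z =ᶠ[𝓝 q]
      fun q => (q, ζ.inChart z q) := by
    filter_upwards [(isOpen_extChartAt_target (cotProj G z)).mem_nhds hq] with w hw using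
      ζ.chartMap_toMap hw
  have hd : HasFDerivAt (fun q => (q, ζ.inChart z q))
      ((ContinuousLinearMap.id ℝ E).prod (fderiv ℝ (ζ.inChart z) q)) q :=
    (hasFDerivAt_id q).prodMk (ζ.chartSmooth.differentiableAt hq).hasFDerivAt
  refine (chartForm_pullForm hq (ζ.mdifferentiableAt_toMap z hq)
    (ζ.toMap_mem_source hq)).trans ?_
  rw [heq.fderiv_eq, heq.eq_of_nhds, hd.fderiv, locPull]

/-- A closed section provides a point of G over every point of M, so charts of M can always be taken
to underlie charts of G. -/
theorem exists_point (ζ : ClosedSection G) (x : M) : ∃ z : G, cotProj G z = x := ⟨ζ.toMap x, rfl⟩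

theorem chartSmooth_pull {η : OneForm (cotModel E) G} (hη : ChartSmooth η) [FiniteDimensional ℝ E] :
    ChartSmooth (ζ.pull η) := by
  intro x
  obtain ⟨z, rfl⟩ := ζ.exists_point x
  exact (ContDiffOn.locPull (isOpen_extChartAt_target _) (ζ.inChart_contDiffOn z)
    (fun q hq => ζ.mem_target hq) (hη z)).congr fun q hq => ζ.chartForm_pull η hq

end ClosedSection

/-! ## The space `J_ξ^∞` -/

variable [FiniteDimensional ℝ E]

/-- Families of smooth one-forms. -/
def smoothFamilies (G : TopologicalSpace.Opens (CotangentBundle E M)) :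
    Submodule ℝ (FormFamily G) where
  carrier := {f | ∀ ζ, ChartSmooth (f ζ)}
  zero_mem' := fun _ _ =>
    (contDiffOn_const (c := 0)).congr fun _ _ => ContinuousLinearMap.zero_comp _
  add_mem' := fun hf hg ζ z => (hf ζ z).add (hg ζ z)
  smul_mem' := fun r _ hf ζ z => (hf ζ z).const_smul r

theorem mem_smoothFamilies {f : FormFamily G} :
    f ∈ smoothFamilies G ↔ ∀ ζ, ChartSmooth (f ζ) := Iff.rfl

theorem etaMap_mem_smoothFamilies {f g : FormFamily G} (hf : f ∈ smoothFamilies G)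
    (hg : g ∈ smoothFamilies G) : etaMap f g ∈ smoothFamilies G :=
  mem_smoothFamilies.2 fun ζ => (mem_smoothFamilies.1 hf ζ).bracket
    (ζ.chartSmooth_pull (mem_smoothFamilies.1 hg ζ))

theorem chartForm_etaMap {f g : FormFamily G} (hf : f ∈ smoothFamilies G)
    (hg : g ∈ smoothFamilies G) (ζ : ClosedSection G) {z : G} {y : E × (E →L[ℝ] ℝ)}
    (hy : y ∈ (extChartAt (cotModel E) z).target) :
    chartForm (etaMap f g ζ) z y =
      locBracket (locPull (ζ.inChart z) (chartForm (g ζ) z)) (chartForm (f ζ) z) y := by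
  refine (chartForm_formBracket (mem_smoothFamilies.1 hf ζ)
    (ζ.chartSmooth_pull (mem_smoothFamilies.1 hg ζ)) hy).trans ?_
  refine locBracket_congr ?_ EventuallyEq.rfl
  filter_upwards [(isOpen_extChartAt_target _).mem_nhds (cot_fst_mem hy)] with q hq using
    ζ.chartForm_pull _ hq

theorem etaMap_comm {f g h : FormFamily G} (hf : f ∈ smoothFamilies G)
    (hg : g ∈ smoothFamilies G) (hh : h ∈ smoothFamilies G) :
    etaMap (etaMap f g) h = etaMap (etaMap f h) g :=
  funext fun ζ => formBracket_horForm_comm (mem_smoothFamilies.1 hf ζ)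
    (ζ.chartSmooth_pull (mem_smoothFamilies.1 hg ζ))
    (ζ.chartSmooth_pull (mem_smoothFamilies.1 hh ζ))

theorem etaMap_add_left {f f' g : FormFamily G} (hf : f ∈ smoothFamilies G)
    (hf' : f' ∈ smoothFamilies G) (hg : g ∈ smoothFamilies G) :
    etaMap (f + f') g = etaMap f g + etaMap f' g := by
  refine funext fun ζ => ext_chartForm fun z y hy => ?_
  rw [chartForm_etaMap (add_mem hf hf') hg ζ hy, Pi.add_apply, Pi.add_apply, chartForm_add,
    chartForm_add, Pi.add_apply, chartForm_etaMap hf hg ζ hy, chartForm_etaMap hf' hg ζ hy]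
  exact locBracket_add_right ((mem_smoothFamilies.1 hf ζ).differentiableAt hy)
    ((mem_smoothFamilies.1 hf' ζ).differentiableAt hy)

theorem etaMap_smul_left (r : ℝ) {f g : FormFamily G} (hf : f ∈ smoothFamilies G)
    (hg : g ∈ smoothFamilies G) : etaMap (r • f) g = r • etaMap f g := by
  refine funext fun ζ => ext_chartForm fun z y hy => ?_
  rw [chartForm_etaMap (Submodule.smul_mem _ r hf) hg ζ hy, Pi.smul_apply, Pi.smul_apply,
    chartForm_smul, chartForm_smul, Pi.smul_apply, chartForm_etaMap hf hg ζ hy]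
  exact locBracket_smul_right r

theorem etaMap_add_right {f g g' : FormFamily G} (hf : f ∈ smoothFamilies G)
    (hg : g ∈ smoothFamilies G) (hg' : g' ∈ smoothFamilies G) :
    etaMap f (g + g') = etaMap f g + etaMap f g' := by
  refine funext fun ζ => ext_chartForm fun z y hy => ?_
  rw [chartForm_etaMap hf (add_mem hg hg') ζ hy, Pi.add_apply, Pi.add_apply, chartForm_add,
    chartForm_add, Pi.add_apply, chartForm_etaMap hf hg ζ hy, chartForm_etaMap hf hg' ζ hy]
  have hd : ∀ {g : FormFamily G}, g ∈ smoothFamilies G →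
      DifferentiableAt ℝ (locPull (ζ.inChart z) (chartForm (g ζ) z)) y.1 := fun {g} hg =>
    ((ContDiffOn.locPull (isOpen_extChartAt_target _) (ζ.inChart_contDiffOn z)
      (fun q hq => ζ.mem_target hq) (mem_smoothFamilies.1 hg ζ z)).contDiffAt
      ((isOpen_extChartAt_target _).mem_nhds
        (cot_fst_mem hy))).differentiableAt (by simp)
  exact locBracket_add_left (hd hg) (hd hg')

theorem etaMap_smul_right (r : ℝ) {f g : FormFamily G} (hf : f ∈ smoothFamilies G)
    (hg : g ∈ smoothFamilies G) : etaMap f (r • g) = r • etaMap f g := by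
  refine funext fun ζ => ext_chartForm fun z y hy => ?_
  rw [chartForm_etaMap hf (Submodule.smul_mem _ r hg) ζ hy, Pi.smul_apply, Pi.smul_apply,
    chartForm_smul, chartForm_smul, Pi.smul_apply, chartForm_etaMap hf hg ζ hy]
  exact locBracket_smul_left (a := locPull (ζ.inChart z) (chartForm (g ζ) z)) r

variable {ξ : OneForm (cotModel E) G}

/-- Bilinearity and commutativity of η rest on differentiability; minimality of J_ξ^∞ makes all its
elements smooth. -/
theorem jetSpace_le_smoothFamilies (hξ : ChartSmooth ξ) : jetSpace ξ ≤ smoothFamilies G :=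
  sInf_le ⟨mem_smoothFamilies.2 fun _ => hξ, fun _ hf _ hg => etaMap_mem_smoothFamilies hf hg⟩

/-- The operation `η` on `J_ξ^∞` as a bilinear map. -/
def jetEtaBilin (hξ : ChartSmooth ξ) : jetSpace ξ →ₗ[ℝ] jetSpace ξ →ₗ[ℝ] jetSpace ξ :=
  LinearMap.mk₂ ℝ jetEta
    (fun f f' g => Subtype.ext (etaMap_add_left (jetSpace_le_smoothFamilies hξ f.2)
      (jetSpace_le_smoothFamilies hξ f'.2) (jetSpace_le_smoothFamilies hξ g.2)))
    (fun r f g => Subtype.ext (etaMap_smul_left r (jetSpace_le_smoothFamilies hξ f.2)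
      (jetSpace_le_smoothFamilies hξ g.2)))
    (fun f g g' => Subtype.ext (etaMap_add_right (jetSpace_le_smoothFamilies hξ f.2)
      (jetSpace_le_smoothFamilies hξ g.2) (jetSpace_le_smoothFamilies hξ g'.2)))
    (fun r f g => Subtype.ext (etaMap_smul_right r (jetSpace_le_smoothFamilies hξ f.2)
      (jetSpace_le_smoothFamilies hξ g.2)))

theorem jetEtaBilin_comm (hξ : ChartSmooth ξ) (f g h : jetSpace ξ) :
    jetEtaBilin hξ (jetEtaBilin hξ f g) h = jetEtaBilin hξ (jetEtaBilin hξ f h) g :=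
  Subtype.ext (etaMap_comm (jetSpace_le_smoothFamilies hξ f.2)
    (jetSpace_le_smoothFamilies hξ g.2) (jetSpace_le_smoothFamilies hξ h.2))

theorem generatedBy_jetEtaBilin (hξ : ChartSmooth ξ) :
    GeneratedBy (jetEtaBilin hξ) (jetGen ξ) := by
  intro p h0 h
  -- Minimality is stated among all families, so p is first pushed forward to that ambient space.
  have hle : jetSpace ξ ≤ p.map (jetSpace ξ).subtype := by
    refine sInf_le ⟨⟨_, h0, rfl⟩, ?_⟩
    rintro _ ⟨f, hf, rfl⟩ _ ⟨g, hg, rfl⟩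
    exact ⟨_, h f hf g hg, rfl⟩
  refine eq_top_iff.2 fun f _ => ?_
  obtain ⟨g, hg, hgf⟩ := hle f.2
  rwa [← Subtype.ext hgf]

/-! ## The elementary differential -/

theorem elemDiff_node (ts : List PlanarTree) : elemDiff ξ (.node ts) = elemDiffForest ξ ts := by
  rw [elemDiff]

theorem elemDiffForest_nil : elemDiffForest ξ [] = fun _ => ξ := by
  rw [elemDiffForest]

theorem elemDiffForest_cons (t : PlanarTree) (ts : List PlanarTree) :
    elemDiffForest ξ (t :: ts) = etaMap (elemDiffForest ξ ts) (elemDiff ξ t) := by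
  rw [elemDiffForest]; rfl

theorem elemDiff_mem (t : PlanarTree) : elemDiff ξ t ∈ jetSpace ξ :=
  PlanarTree.rec (motive_1 := fun t => elemDiff ξ t ∈ jetSpace ξ)
    (motive_2 := fun ts => elemDiffForest ξ ts ∈ jetSpace ξ)
    (fun _ h => elemDiff_node (ξ := ξ) _ ▸ h) (elemDiffForest_nil (ξ := ξ) ▸ const_mem_jetSpace ξ)
    (fun _ _ h1 h2 => elemDiffForest_cons (ξ := ξ) _ _ ▸ etaMap_mem_jetSpace ξ h2 h1) t

theorem elemDiffForest_mem (ts : List PlanarTree) : elemDiffForest ξ ts ∈ jetSpace ξ :=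
  elemDiff_node (ξ := ξ) ts ▸ elemDiff_mem (.node ts)

/-- Swapping adjacent branches swaps two successive horizontal brackets, which commute. This is what
lets the elementary differential descend to non-planar trees. -/
theorem elemDiffForest_perm (hξ : ChartSmooth ξ) {l l' : List PlanarTree} (h : l.Perm l') :
    elemDiffForest ξ l = elemDiffForest ξ l' := by
  have hle := jetSpace_le_smoothFamilies hξ
  induction h with
  | nil => rfl
  | cons x _ ih => rw [elemDiffForest_cons, elemDiffForest_cons, ih]
  | swap x y l =>
    simp only [elemDiffForest_cons]
    exact etaMap_comm (hle (elemDiffForest_mem l)) (hle (elemDiff_mem x)) (hle (elemDiff_mem y))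
  | trans _ _ ih1 ih2 => exact ih1.trans ih2

theorem elemDiff_reorder (hξ : ChartSmooth ξ) {t u : PlanarTree} (h : t.Reorder u) :
    elemDiff ξ t = elemDiff ξ u := by
  induction h with
  | perm hp => rw [elemDiff_node, elemDiff_node, elemDiffForest_perm hξ hp]
  | branch l r hab ih =>
    rw [elemDiff_node, elemDiff_node]
    induction l with
    | nil => rw [List.nil_append, List.nil_append, elemDiffForest_cons, elemDiffForest_cons, ih]
    | cons x l ihl =>
      rw [List.cons_append, List.cons_append, elemDiffForest_cons, elemDiffForest_cons, ihl]

/-- The elementary differential of a Butcher tree. -/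
def treeDiff (hξ : ChartSmooth ξ) : ButcherTree → jetSpace ξ :=
  Quot.lift (fun t => ⟨elemDiff ξ t, elemDiff_mem t⟩)
    fun _ _ h => Subtype.ext (elemDiff_reorder hξ h)

theorem treeDiff_mk (hξ : ChartSmooth ξ) (t : PlanarTree) :
    treeDiff hξ (ButcherTree.mk t) = ⟨elemDiff ξ t, elemDiff_mem t⟩ := rfl

theorem treeDiff_attach_mk (hξ : ChartSmooth ξ) (ts : List PlanarTree) (s : PlanarTree) :
    treeDiff hξ (ButcherTree.attach (ButcherTree.mk (.node ts)) (ButcherTree.mk s)) =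
      jetEta (treeDiff hξ (ButcherTree.mk (.node ts))) (treeDiff hξ (ButcherTree.mk s)) := by
  rw [ButcherTree.attach_mk, treeDiff_mk, treeDiff_mk, treeDiff_mk]
  refine Subtype.ext ?_
  change elemDiff ξ _ = etaMap (elemDiff ξ _) (elemDiff ξ _)
  rw [elemDiff_node, elemDiff_node, elemDiffForest_cons]

theorem treeDiff_attach (hξ : ChartSmooth ξ) (τ σ : ButcherTree) :
    treeDiff hξ (ButcherTree.attach τ σ) = jetEta (treeDiff hξ τ) (treeDiff hξ σ) := by
  induction τ using Quot.ind with | mk t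
  induction σ using Quot.ind with | mk s
  cases t with | node ts
  exact treeDiff_attach_mk hξ ts s

/-- The elementary differential as a linear map. -/
def elemDiffLin (hξ : ChartSmooth ξ) : TreeSpace →ₗ[ℝ] jetSpace ξ :=
  Finsupp.linearCombination ℝ (treeDiff hξ)

theorem elemDiffLin_single (hξ : ChartSmooth ξ) (τ : ButcherTree) :
    elemDiffLin hξ (Finsupp.single τ 1) = treeDiff hξ τ := by
  rw [elemDiffLin, Finsupp.linearCombination_single, one_smul]

theorem elemDiffLin_treeGen (hξ : ChartSmooth ξ) : elemDiffLin hξ treeGen = jetGen ξ := by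
  rw [treeGen, ButcherTree.leaf_eq, elemDiffLin_single]
  refine Subtype.ext ?_
  change elemDiff ξ _ = _
  rw [elemDiff_node, elemDiffForest_nil]
  rfl

/-- The outermost bracket belongs to the first branch in the list, so attaching a branch is one
further application of η. -/
theorem elemDiffLin_attaching (hξ : ChartSmooth ξ) (x y : TreeSpace) :
    elemDiffLin hξ (attaching x y) =
      jetEtaBilin hξ (elemDiffLin hξ x) (elemDiffLin hξ y) := by
  refine map_attaching_of_single (F := elemDiffLin hξ) (b := jetEtaBilin hξ) (fun τ σ => ?_) x y
  exact (elemDiffLin_single hξ _).trans ((treeDiff_attach hξ τ σ).trans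
    (congrArg₂ jetEta (elemDiffLin_single hξ τ).symm (elemDiffLin_single hξ σ).symm))

theorem elemDiffLin_grafting (hξ : ChartSmooth ξ)
    {m : jetSpace ξ →ₗ[ℝ] jetSpace ξ →ₗ[ℝ] jetSpace ξ} (hm : IsJetProduct ξ m)
    (a b : TreeSpace) : elemDiffLin hξ (grafting a b) = m (elemDiffLin hξ a) (elemDiffLin hξ b) :=
  map_grafting (elemDiffLin_treeGen hξ) (elemDiffLin_attaching hξ) hm.1 hm.2 a b

theorem isLeftPreLie_of_isJetProduct (hξ : ChartSmooth ξ)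
    {m : jetSpace ξ →ₗ[ℝ] jetSpace ξ →ₗ[ℝ] jetSpace ξ} (hm : IsJetProduct ξ m) :
    IsLeftPreLie (V := jetSpace ξ) m :=
  isLeftPreLie_of_derivation (generatedBy_jetEtaBilin hξ) (jetEtaBilin_comm hξ) hm.1 hm.2

end Sections

/-! ## Variations of closed sections -/

section Variations

open Topology Filter

variable {E : Type*} [NormedAddCommGroup E] [NormedSpace ℝ E]
  {M : Type*} [TopologicalSpace M] [ChartedSpace E M] [IsManifold 𝓘(ℝ, E) ∞ M]
  {G : TopologicalSpace.Opens (CotangentBundle E M)}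

/-- Joint continuity in t and x is what the compactness argument for deformed sections requires. -/
theorem continuousAt_graph_add_smul {η θ : OneForm 𝓘(ℝ, E) M} (hη : ChartSmooth η)
    (hθ : ChartSmooth θ) (t : ℝ) (x : M) :
    ContinuousAt (fun p : ℝ × M => (⟨p.2, η p.2 + p.1 • θ p.2⟩ : CotangentBundle E M)) (t, x) := by
  rw [continuousAt_hom_bundle]
  refine ⟨continuousAt_snd, ?_⟩
  have hx := mem_extChartAt_target (I := 𝓘(ℝ, E)) x
  have hext : ContinuousAt (fun p : ℝ × M => extChartAt 𝓘(ℝ, E) x p.2) (t, x) :=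
    ContinuousAt.comp (f := Prod.snd) (g := extChartAt 𝓘(ℝ, E) x) (x := (t, x))
      (continuousAt_extChartAt x) continuousAt_snd
  have hc : ∀ {η : OneForm 𝓘(ℝ, E) M}, ChartSmooth η →
      ContinuousAt (fun p : ℝ × M => chartForm η x (extChartAt 𝓘(ℝ, E) x p.2)) (t, x) := fun h =>
    ContinuousAt.comp (f := fun p : ℝ × M => extChartAt 𝓘(ℝ, E) x p.2) (x := (t, x))
      (g := chartForm _ x) (h.differentiableAt hx).continuousAt hext
  refine ((hc hη).add (continuousAt_fst.smul (hc hθ))).congr ?_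
  filter_upwards [continuousAt_snd.eventually
    ((isOpen_extChartAt_source (I := 𝓘(ℝ, E)) x).eventually_mem (mem_extChartAt_source x))]
    with p hp
  refine Eq.trans ?_ (inCoordinates_eq_chartForm (I := 𝓘(ℝ, E)) (η + p.1 • θ) hp).symm
  rw [chartForm_add, chartForm_smul]
  rfl

theorem ClosedSection.ext_toForm {ζ ζ' : ClosedSection G} (h : ζ.toForm = ζ'.toForm) : ζ = ζ' := by
  cases ζ; cases ζ'; cases h; rfl

/-- A closed section can be deformed, through closed sections, in the direction of a closed one-form
which is prescribed near a given point. -/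
theorem ClosedSection.exists_variation [FiniteDimensional ℝ E] [T2Space M] (ζ : ClosedSection G)
    {β : OneForm 𝓘(ℝ, E) M} (hβ : β ∈ closedForms 𝓘(ℝ, E) M) (x₀ : M) :
    ∃ ψ ∈ closedForms 𝓘(ℝ, E) M,
      (∀ᶠ q in 𝓝 (extChartAt 𝓘(ℝ, E) x₀ x₀), chartForm ψ x₀ q = chartForm β x₀ q) ∧
      ∃ c : ℝ → ClosedSection G, c 0 = ζ ∧ ∀ᶠ t in 𝓝 (0 : ℝ), (c t).toForm = ζ.toForm + t • ψ := by
  classical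
  -- The direction β itself could push the graph out of G far away; dg agrees with it near x₀ and
  -- has compact support.
  obtain ⟨g, hg, hgc, hgβ⟩ := exists_dFun_eventuallyEq hβ x₀
  have hψ := dFun_mem_closedForms hg
  set ψ : OneForm 𝓘(ℝ, E) M := dFun g with hψ_def
  have hζ : ζ.toForm ∈ closedForms 𝓘(ℝ, E) M := ⟨isSmoothForm_iff.1 ζ.smooth, ζ.closed⟩
  have hmem : ∀ t : ℝ, ζ.toForm + t • ψ ∈ closedForms 𝓘(ℝ, E) M := fun t =>
    add_mem hζ (Submodule.smul_mem _ t hψ)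
  -- G is open and contains the graph at t = 0, so over the compact support one interval of t works
  -- for all points; off the support the section does not move.
  have hgraph : ∀ᶠ t in 𝓝 (0 : ℝ), ∀ x ∈ tsupport g,
      (⟨x, (ζ.toForm + t • ψ) x⟩ : CotangentBundle E M) ∈ G := by
    refine IsCompact.eventually_forall_of_forall_eventually hgc fun x _ => ?_
    refine (continuousAt_graph_add_smul hζ.1 hψ.1 0 x).eventually (G.isOpen.eventually_mem ?_)
    have e : ζ.toForm x + (0 : ℝ) • ψ x = ζ.toForm x := by rw [zero_smul, add_zero]
    change (⟨x, ζ.toForm x + (0 : ℝ) • ψ x⟩ : CotangentBundle E M) ∈ G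
    rw [e]
    exact ζ.graph_mem x
  have hgraph' : ∀ᶠ t in 𝓝 (0 : ℝ), ∀ x,
      (⟨x, (ζ.toForm + t • ψ) x⟩ : CotangentBundle E M) ∈ G := by
    filter_upwards [hgraph] with t ht x
    by_cases hx : x ∈ tsupport g
    · exact ht x hx
    · have h0 : ψ x = 0 := by
        have heq : g =ᶠ[𝓝 x] fun _ => (0 : ℝ) := notMem_tsupport_iff_eventuallyEq.1 hx
        exact heq.mfderiv_eq.trans mfderiv_const
      have e : (ζ.toForm + t • ψ) x = ζ.toForm x := by
        change ζ.toForm x + t • ψ x = _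
        rw [h0, smul_zero, add_zero]
      exact e ▸ ζ.graph_mem x
  -- The value ζ for the remaining t is a default that makes c total; only t near 0 matters.
  let c : ℝ → ClosedSection G := fun t =>
    if h : ∀ x, (⟨x, (ζ.toForm + t • ψ) x⟩ : CotangentBundle E M) ∈ G then
      ⟨ζ.toForm + t • ψ, isSmoothForm_iff.2 (hmem t).1, (hmem t).2, h⟩ else ζ
  have hct : ∀ᶠ t in 𝓝 (0 : ℝ), (c t).toForm = ζ.toForm + t • ψ := by
    filter_upwards [hgraph'] with t ht
    rw [show c t = _ from dif_pos ht]
  refine ⟨ψ, hψ, hgβ, c, ClosedSection.ext_toForm ?_, hct⟩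
  rw [hct.self_of_nhds, zero_smul, add_zero]

end Variations

/-! ## Grafting as a directional derivative -/

section Directional

open Topology Filter

variable {E : Type*} [NormedAddCommGroup E] [NormedSpace ℝ E] [FiniteDimensional ℝ E]
  {M : Type*} [TopologicalSpace M] [ChartedSpace E M] [IsManifold 𝓘(ℝ, E) ∞ M]
  {G : TopologicalSpace.Opens (CotangentBundle E M)} {ξ : OneForm (cotModel E) G}

/-- The part of the chart of `G` at `z` over a subset of the chart of `M`. -/
def cotChartOver (z : G) (W : Set E) : Set (E × (E →L[ℝ] ℝ)) :=
  (extChartAt (cotModel E) z).target ∩ Prod.fst ⁻¹' W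

theorem isOpen_cotChartOver (z : G) {W : Set E} (hW : IsOpen W) : IsOpen (cotChartOver z W) :=
  (isOpen_extChartAt_target z).inter (hW.preimage continuous_fst)

-- Lines of closed sections in a chart

section Line

variable {c : ℝ → ClosedSection G} {S : Set ℝ} {ζ : ClosedSection G} {ψ : OneForm 𝓘(ℝ, E) M}
  {z : G} {W : Set E}

theorem inChart_eq_of_line (hct : ∀ t ∈ S, (c t).toForm = ζ.toForm + t • ψ) {t : ℝ} (ht : t ∈ S) :
    (c t).inChart z = ζ.inChart z + t • chartForm ψ (cotProj G z) := by
  rw [ClosedSection.inChart, hct t ht, chartForm_add, chartForm_smul]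

theorem smoothFamilyOn_inChart (hct : ∀ t ∈ S, (c t).toForm = ζ.toForm + t • ψ)
    (hψ : ChartSmooth ψ) (hWt : W ⊆ (extChartAt 𝓘(ℝ, E) (cotProj G z)).target) :
    SmoothFamilyOn (fun t => (c t).inChart z) S W := by
  have h1 : SmoothFamilyOn (fun _ => ζ.inChart z) S W :=
    smoothFamilyOn_const ((ζ.inChart_contDiffOn z).mono hWt)
  have h2 : SmoothFamilyOn (fun _ => chartForm ψ (cotProj G z)) S W :=
    smoothFamilyOn_const ((hψ _).mono hWt)
  refine (ContDiffOn.add h1 (contDiffOn_fst.smul h2)).congr fun p hp => ?_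
  exact congrFun (inChart_eq_of_line hct hp.1) p.2

theorem paramDeriv_inChart (hS : S ∈ 𝓝 (0 : ℝ))
    (hct : ∀ t ∈ S, (c t).toForm = ζ.toForm + t • ψ) :
    paramDeriv (fun t => (c t).inChart z) = chartForm ψ (cotProj G z) := by
  funext q
  have h : (fun t => (c t).inChart z q) =ᶠ[𝓝 0]
      fun t => ζ.inChart z q + t • chartForm ψ (cotProj G z) q := by
    filter_upwards [hS] with t ht using congrFun (inChart_eq_of_line hct ht) q
  have h2 : HasDerivAt (fun t : ℝ => ζ.inChart z q + t • chartForm ψ (cotProj G z) q)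
      ((1 : ℝ) • chartForm ψ (cotProj G z) q) 0 :=
    ((hasDerivAt_id (0 : ℝ)).smul_const _).const_add _
  rw [paramDeriv, h.deriv_eq, h2.deriv, one_smul]

end Line

/-- The elements `x` such that `B x` is the derivative of `A x`, corrected by the bracket with
`a`. -/
def variationSubmodule {V : Type*} [AddCommGroup V] [Module ℝ V]
    {S : Set ℝ} {Ω : Set (E × (E →L[ℝ] ℝ))} (hS : IsOpen S) (h0 : 0 ∈ S) (hΩ : IsOpen Ω)
    (A : V →ₗ[ℝ] ℝ → E × (E →L[ℝ] ℝ) → (E × (E →L[ℝ] ℝ)) →L[ℝ] ℝ)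
    (B : V →ₗ[ℝ] E × (E →L[ℝ] ℝ) → (E × (E →L[ℝ] ℝ)) →L[ℝ] ℝ) (a : E → E →L[ℝ] ℝ) :
    Submodule ℝ V where
  carrier := {x | SmoothFamilyOn (A x) S Ω ∧
    ∀ y ∈ Ω, B x y = locBracket a (A x 0) y + paramDeriv (A x) y}
  zero_mem' := by
    refine ⟨?_, fun y _ => ?_⟩
    · rw [map_zero]; exact contDiffOn_const
    · have e1 : locBracket a (0 : E × (E →L[ℝ] ℝ) → (E × (E →L[ℝ] ℝ)) →L[ℝ] ℝ) y = 0 := by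
        have := locBracket_smul_right (a := a)
          (f := (0 : E × (E →L[ℝ] ℝ) → (E × (E →L[ℝ] ℝ)) →L[ℝ] ℝ)) (y := y) 0
        rwa [zero_smul, zero_smul] at this
      have e2 : paramDeriv (0 : ℝ → E × (E →L[ℝ] ℝ) → (E × (E →L[ℝ] ℝ)) →L[ℝ] ℝ) y = 0 :=
        deriv_const _ _
      rw [map_zero, map_zero, e2, Pi.zero_apply, Pi.zero_apply, e1, add_zero]
  add_mem' := by
    rintro u v ⟨hu, hu'⟩ ⟨hv, hv'⟩
    refine ⟨?_, fun y hy => ?_⟩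
    · rw [map_add]; exact ContDiffOn.add hu hv
    · have d1 := ((hu.contDiffOn h0).contDiffAt (hΩ.mem_nhds hy)).differentiableAt (by simp)
      have d2 := ((hv.contDiffOn h0).contDiffAt (hΩ.mem_nhds hy)).differentiableAt (by simp)
      have e : paramDeriv (A u + A v) y = paramDeriv (A u) y + paramDeriv (A v) y :=
        ((hu.hasDerivAt hS hΩ h0 hy).add (hv.hasDerivAt hS hΩ h0 hy)).deriv
      rw [map_add, map_add, e, Pi.add_apply, Pi.add_apply, locBracket_add_right d1 d2, hu' y hy,
        hv' y hy]
      abel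
  smul_mem' := by
    rintro r u ⟨hu, hu'⟩
    refine ⟨?_, fun y hy => ?_⟩
    · rw [map_smul]; exact ContDiffOn.const_smul r hu
    · have e : paramDeriv (r • A u) y = r • paramDeriv (A u) y :=
        ((hu.hasDerivAt hS hΩ h0 hy).const_smul r).deriv
      rw [map_smul, map_smul, e, Pi.smul_apply, Pi.smul_apply, locBracket_smul_right, hu' y hy,
        smul_add]

/-- The chart expression as a linear map. -/
def chartFormLin (z : G) : OneForm (cotModel E) G →ₗ[ℝ]
    E × (E →L[ℝ] ℝ) → (E × (E →L[ℝ] ℝ)) →L[ℝ] ℝ where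
  toFun η := chartForm η z
  map_add' η θ := chartForm_add η θ z
  map_smul' r η := chartForm_smul r η z

variable {Φ : TreeSpace →ₗ[ℝ] FormFamily G}

/-- The chart expressions of a linear family along a curve of closed sections. -/
def chartCurve (Φ : TreeSpace →ₗ[ℝ] FormFamily G) (c : ℝ → ClosedSection G) (z : G) :
    TreeSpace →ₗ[ℝ] ℝ → E × (E →L[ℝ] ℝ) → (E × (E →L[ℝ] ℝ)) →L[ℝ] ℝ :=
  LinearMap.pi fun t => (chartFormLin z).comp ((LinearMap.proj (c t)).comp Φ)

/-- The variation of `etaMap f g` along a line of closed sections, from those of `f` and `g`. -/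
theorem chartForm_etaMap_variation {f g f' g' : FormFamily G} (hf : f ∈ smoothFamilies G)
    (hg : g ∈ smoothFamilies G) (hf' : f' ∈ smoothFamilies G) (hg' : g' ∈ smoothFamilies G)
    {c : ℝ → ClosedSection G} {S : Set ℝ} {ψ : OneForm 𝓘(ℝ, E) M}
    {z : G} {W : Set E} (hS : IsOpen S) (h0 : 0 ∈ S) (hW : IsOpen W)
    (hWt : W ⊆ (extChartAt 𝓘(ℝ, E) (cotProj G z)).target)
    (hct : ∀ t ∈ S, (c t).toForm = (c 0).toForm + t • ψ) (hψ : ψ ∈ closedForms 𝓘(ℝ, E) M)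
    (hu : SmoothFamilyOn (fun t => chartForm (f (c t)) z) S (cotChartOver z W))
    (hu' : ∀ y ∈ cotChartOver z W, chartForm (f' (c 0)) z y =
      locBracket (chartForm ψ (cotProj G z)) (chartForm (f (c 0)) z) y +
        paramDeriv (fun t => chartForm (f (c t)) z) y)
    (hv : SmoothFamilyOn (fun t => chartForm (g (c t)) z) S (cotChartOver z W))
    (hv' : ∀ y ∈ cotChartOver z W, chartForm (g' (c 0)) z y =
      locBracket (chartForm ψ (cotProj G z)) (chartForm (g (c 0)) z) y +
        paramDeriv (fun t => chartForm (g (c t)) z) y) :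
    SmoothFamilyOn (fun t => chartForm (etaMap f g (c t)) z) S (cotChartOver z W) ∧
    ∀ y ∈ cotChartOver z W,
      chartForm (etaMap f' g (c 0)) z y + chartForm (etaMap f g' (c 0)) z y =
      locBracket (chartForm ψ (cotProj G z)) (chartForm (etaMap f g (c 0)) z) y +
        paramDeriv (fun t => chartForm (etaMap f g (c t)) z) y := by
  have hΩ : IsOpen (cotChartOver z W) := isOpen_cotChartOver z hW
  have hΩW : ∀ y ∈ cotChartOver z W, y.1 ∈ W := fun y hy => hy.2
  have hc := smoothFamilyOn_inChart hct hψ.1 hWt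
  have hċ : paramDeriv (fun t => (c t).inChart z) = chartForm ψ (cotProj G z) :=
    paramDeriv_inChart (hS.mem_nhds h0) hct
  have hcΩ : ∀ t ∈ S, ∀ q ∈ W, (q, (c t).inChart z q) ∈ cotChartOver z W := fun t _ q hq =>
    ⟨(c t).mem_target (hWt hq), hq⟩
  have hclosed : ∀ q ∈ W, ∀ u v, fderiv ℝ (paramDeriv (fun t => (c t).inChart z)) q u v =
      fderiv ℝ (paramDeriv (fun t => (c t).inChart z)) q v u := fun q hq u v => by
    rw [hċ]; exact fderiv_chartForm_symm hψ.1 hψ.2 (hWt hq) u v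
  have hcf : ∀ t, ∀ y ∈ cotChartOver z W, chartForm (etaMap f g (c t)) z y =
      locBracket (locPull ((c t).inChart z) (chartForm (g (c t)) z))
        (chartForm (f (c t)) z) y := fun t y hy => chartForm_etaMap hf hg (c t) hy.1
  refine ⟨ContDiffOn.congr (SmoothFamilyOn.locBracket hS hΩ hW hΩW
    (SmoothFamilyOn.locPull hS hW hc hcΩ hv) hu) fun q hq => hcf q.1 q.2 hq.2, fun y hy => ?_⟩
  have e1 : locBracket (chartForm ψ (cotProj G z)) (chartForm (etaMap f g (c 0)) z) y =
      locBracket (chartForm ψ (cotProj G z))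
        (locBracket (locPull ((c 0).inChart z) (chartForm (g (c 0)) z))
          (chartForm (f (c 0)) z)) y := by
    refine locBracket_congr EventuallyEq.rfl ?_
    filter_upwards [hΩ.mem_nhds hy] with w hw using hcf 0 w hw
  have e2 : paramDeriv (fun t => chartForm (etaMap f g (c t)) z) y =
      paramDeriv (fun t => locBracket (locPull ((c t).inChart z) (chartForm (g (c t)) z))
        (chartForm (f (c t)) z)) y :=
    congrArg (deriv · 0) (funext fun t => hcf t y hy)
  have hvar := variation_locBracket hS hΩ hW hΩW h0 hc hcΩ hu hv hclosed hy
  rw [hċ] at hvar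
  -- The variation identity of the coordinate bracket is now matched with the chart expressions of
  -- f' and g', which by `hu'` and `hv'` are the corrected derivatives of f and g.
  refine Eq.trans ?_ (hvar.symm.trans (congrArg₂ (· + ·) e1 e2).symm)
  refine congrArg₂ (· + ·) ((chartForm_etaMap hf' hg (c 0) hy.1).trans ?_)
    ((chartForm_etaMap hf hg' (c 0) hy.1).trans ?_)
  · refine locBracket_congr EventuallyEq.rfl ?_
    filter_upwards [hΩ.mem_nhds hy] with w hw using hu' w hw
  · refine locBracket_congr ?_ EventuallyEq.rfl
    filter_upwards [hW.mem_nhds (hΩW y hy)] with q hq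
    exact congrArg (fun L : (E × (E →L[ℝ] ℝ)) →L[ℝ] ℝ =>
      L.comp ((ContinuousLinearMap.id ℝ E).prod (fderiv ℝ ((c 0).inChart z) q)))
      (hv' _ (hcΩ 0 h0 q hq))

/-- Along a line of closed sections whose velocity is locally the pull-back of `Φ b`, grafting `b`
is the derivative of `Φ`, corrected by a vertical Lie derivative. -/
theorem chartForm_map_grafting (hΦ : ∀ x, Φ x ∈ smoothFamilies G)
    (hgen : Φ treeGen = fun _ => ξ) (hatt : ∀ x y, Φ (attaching x y) = etaMap (Φ x) (Φ y))
    {c : ℝ → ClosedSection G} {S : Set ℝ} {ψ : OneForm 𝓘(ℝ, E) M}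
    {z : G} {W : Set E} (hS : IsOpen S) (h0 : 0 ∈ S) (hW : IsOpen W)
    (hWt : W ⊆ (extChartAt 𝓘(ℝ, E) (cotProj G z)).target)
    (hct : ∀ t ∈ S, (c t).toForm = (c 0).toForm + t • ψ) (hψ : ψ ∈ closedForms 𝓘(ℝ, E) M)
    (b : TreeSpace)
    (hψb : ∀ q ∈ W, chartForm ψ (cotProj G z) q =
      chartForm ((c 0).pull (Φ b (c 0))) (cotProj G z) q) (x : TreeSpace) :
    SmoothFamilyOn (fun t => chartForm (Φ x (c t)) z) S (cotChartOver z W) ∧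
    ∀ y ∈ cotChartOver z W, chartForm (Φ (grafting b x) (c 0)) z y =
      locBracket (chartForm ψ (cotProj G z)) (chartForm (Φ x (c 0)) z) y +
        paramDeriv (fun t => chartForm (Φ x (c t)) z) y := by
  let B : TreeSpace →ₗ[ℝ] E × (E →L[ℝ] ℝ) → (E × (E →L[ℝ] ℝ)) →L[ℝ] ℝ :=
    (chartFormLin z).comp ((LinearMap.proj (c 0)).comp (Φ.comp (grafting b)))
  suffices h : variationSubmodule hS h0 (isOpen_cotChartOver z hW) (chartCurve Φ c z) B
      (chartForm ψ (cotProj G z)) = ⊤ by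
    have hx : x ∈ variationSubmodule hS h0 (isOpen_cotChartOver z hW) (chartCurve Φ c z) B
      (chartForm ψ (cotProj G z)) := h ▸ Submodule.mem_top
    exact hx
  refine generatedBy_attaching _ ?_ ?_
  -- At the one-node tree the family is constant in ζ, so only the bracket with ψ remains. By the
  -- choice of ψ near the point this is η(ξ, Φ b), the image of b grafted on one node.
  · have hξ : ChartSmooth ξ := by
      have := mem_smoothFamilies.1 (hΦ treeGen) (c 0)
      rwa [hgen] at this
    have hg : chartCurve Φ c z treeGen = fun _ => chartForm ξ z := funext fun t =>
      congrArg (fun f : FormFamily G => chartForm (f (c t)) z) hgen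
    refine ⟨?_, fun y hy => ?_⟩
    · rw [hg]
      exact smoothFamilyOn_const ((hξ z).mono fun y hy => hy.1)
    · have e : paramDeriv (fun _ : ℝ => chartForm ξ z) y = 0 := deriv_const _ _
      have e2 : B treeGen y = locBracket (locPull ((c 0).inChart z) (chartForm (Φ b (c 0)) z))
          (chartForm (Φ treeGen (c 0)) z) y :=
        (congrArg (fun f : FormFamily G => chartForm (f (c 0)) z y)
          ((congrArg Φ (grafting_treeGen b)).trans (hatt treeGen b))).trans
          (chartForm_etaMap (hΦ _) (hΦ _) (c 0) hy.1)
      rw [hg, e, add_zero, e2, hgen]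
      refine locBracket_congr ?_ EventuallyEq.rfl
      filter_upwards [hW.mem_nhds hy.2] with q hq
      exact ((c 0).chartForm_pull _ (hWt hq)).symm.trans (hψb q hq).symm
  · rintro u ⟨hu, hu'⟩ v ⟨hv, hv'⟩
    obtain ⟨h1, h2⟩ := chartForm_etaMap_variation (hΦ u) (hΦ v) (hΦ (grafting b u))
      (hΦ (grafting b v)) hS h0 hW hWt hct hψ hu hu' hv hv'
    have e : chartCurve Φ c z (attaching u v) =
        fun t => chartForm (etaMap (Φ u) (Φ v) (c t)) z := funext fun t =>
      congrArg (fun f : FormFamily G => chartForm (f (c t)) z) (hatt u v)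
    have e2 : Φ (grafting b (attaching u v)) =
        etaMap (Φ (grafting b u)) (Φ v) + etaMap (Φ u) (Φ (grafting b v)) := by
      rw [grafting_attaching, map_add, hatt, hatt]
    refine ⟨e ▸ h1, fun y hy => ?_⟩
    rw [e]
    refine Eq.trans ?_ (h2 y hy)
    refine (congrArg (fun f : FormFamily G => chartForm (f (c 0)) z y) e2).trans ?_
    exact congrFun (chartForm_add (etaMap (Φ (grafting b u)) (Φ v) (c 0))
      (etaMap (Φ u) (Φ (grafting b v)) (c 0)) z) y

/-- The situation of `chartForm_map_grafting` can be realised around every point. -/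
theorem exists_line [T2Space M] (ζ : ClosedSection G) {β : OneForm 𝓘(ℝ, E) M}
    (hβ : β ∈ closedForms 𝓘(ℝ, E) M) (z : G) :
    ∃ (c : ℝ → ClosedSection G) (S : Set ℝ) (ψ : OneForm 𝓘(ℝ, E) M) (W : Set E),
      c 0 = ζ ∧ IsOpen S ∧ 0 ∈ S ∧ IsOpen W ∧
      extChartAt 𝓘(ℝ, E) (cotProj G z) (cotProj G z) ∈ W ∧
      W ⊆ (extChartAt 𝓘(ℝ, E) (cotProj G z)).target ∧
      (∀ t ∈ S, (c t).toForm = (c 0).toForm + t • ψ) ∧ ψ ∈ closedForms 𝓘(ℝ, E) M ∧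
      ∀ q ∈ W, chartForm ψ (cotProj G z) q = chartForm β (cotProj G z) q := by
  obtain ⟨ψ, hψ, hloc, c, rfl, hc⟩ := ζ.exists_variation hβ (cotProj G z)
  obtain ⟨S, hS, hSo, h0⟩ := eventually_nhds_iff.1 hc
  obtain ⟨W, hW, hWo, hz⟩ := eventually_nhds_iff.1 (hloc.and
    ((isOpen_extChartAt_target (I := 𝓘(ℝ, E)) (cotProj G z)).eventually_mem
      (mem_extChartAt_target _)))
  exact ⟨c, S, ψ, W, rfl, hSo, h0, hWo, hz, fun q hq => (hW q hq).2, hS, hψ,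
    fun q hq => (hW q hq).1⟩

variable [T2Space M]

/-- If the pull-backs of `Φ b` are closed, grafting `b` preserves the kernel of `Φ`. -/
theorem map_grafting_eq_zero_right (hΦ : ∀ x, Φ x ∈ smoothFamilies G)
    (hgen : Φ treeGen = fun _ => ξ) (hatt : ∀ x y, Φ (attaching x y) = etaMap (Φ x) (Φ y))
    {b : TreeSpace} (hb : ∀ ζ : ClosedSection G, ζ.pull (Φ b ζ) ∈ closedForms 𝓘(ℝ, E) M)
    {x : TreeSpace} (hx : Φ x = 0) : Φ (grafting b x) = 0 := by
  refine funext fun ζ => funext fun z => ?_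
  obtain ⟨c, S, ψ, W, rfl, hS, h0, hW, hzW, hWt, hct, hψ, hψb⟩ := exists_line ζ (hb ζ) z
  have hy : extChartAt (cotModel E) z z ∈ cotChartOver z W := by
    refine ⟨mem_extChartAt_target z, ?_⟩
    have := cot_extChartAt_apply (mem_extChartAt_source (I := cotModel E) z)
    rw [Set.mem_preimage, this]
    exact hzW
  have hz : ∀ ζ : ClosedSection G, chartForm (Φ x ζ) z = 0 := fun ζ => by
    rw [hx]; exact funext fun _ => ContinuousLinearMap.zero_comp _
  have hd := (chartForm_map_grafting hΦ hgen hatt hS h0 hW hWt hct hψ b hψb x).2 _ hy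
  -- The right-hand side sees x only through Φ x, so it is the same for x as for 0; evaluating at 0
  -- shows that it vanishes.
  have hd' := (chartForm_map_grafting hΦ hgen hatt hS h0 hW hWt hct hψ b hψb 0).2 _ hy
  have h0' : ∀ ζ : ClosedSection G, chartForm (Φ 0 ζ) z = 0 := fun ζ => by
    rw [map_zero]; exact funext fun _ => ContinuousLinearMap.zero_comp _
  simp only [hz] at hd
  simp only [h0', map_zero (grafting b)] at hd'
  have h := eq_of_chartForm_eq (θ := (0 : OneForm (cotModel E) G)) (mem_extChartAt_target z)
    ((hd.trans hd'.symm).trans (ContinuousLinearMap.zero_comp _).symm)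
  rwa [extChartAt_to_inv] at h

/-- If the pull-backs of `Φ b` and `Φ x` are closed, so are those of `Φ (b ↷ x)`. -/
theorem pull_map_grafting_mem_closedForms (hΦ : ∀ x, Φ x ∈ smoothFamilies G)
    (hgen : Φ treeGen = fun _ => ξ) (hatt : ∀ x y, Φ (attaching x y) = etaMap (Φ x) (Φ y))
    {b x : TreeSpace} (hb : ∀ ζ : ClosedSection G, ζ.pull (Φ b ζ) ∈ closedForms 𝓘(ℝ, E) M)
    (hx : ∀ ζ : ClosedSection G, ζ.pull (Φ x ζ) ∈ closedForms 𝓘(ℝ, E) M) (ζ : ClosedSection G) :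
    ζ.pull (Φ (grafting b x) ζ) ∈ closedForms 𝓘(ℝ, E) M := by
  refine ⟨ζ.chartSmooth_pull (mem_smoothFamilies.1 (hΦ _) ζ), fun x₀ => ?_⟩
  obtain ⟨z, rfl⟩ := ζ.exists_point x₀
  obtain ⟨c, S, ψ, W, rfl, hS, h0, hW, hzW, hWt, hct, hψ, hψb⟩ := exists_line ζ (hb ζ) z
  obtain ⟨hs, hd⟩ := chartForm_map_grafting hΦ hgen hatt hS h0 hW hWt hct hψ b hψb x
  have hc := smoothFamilyOn_inChart hct hψ.1 hWt
  have hċ : paramDeriv (fun t => (c t).inChart z) = chartForm ψ (cotProj G z) :=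
    paramDeriv_inChart (hS.mem_nhds h0) hct
  have hcΩ : ∀ t ∈ S, ∀ q ∈ W, (q, (c t).inChart z q) ∈ cotChartOver z W := fun t _ q hq =>
    ⟨(c t).mem_target (hWt hq), hq⟩
  have hp : ∀ t, ∀ q ∈ W, chartForm ((c t).pull (Φ x (c t))) (cotProj G z) q =
      locPull ((c t).inChart z) (chartForm (Φ x (c t)) z) q := fun t q hq =>
    (c t).chartForm_pull _ (hWt hq)
  have hP : SmoothFamilyOn (fun t => chartForm ((c t).pull (Φ x (c t))) (cotProj G z)) S W :=
    ContDiffOn.congr (SmoothFamilyOn.locPull hS hW hc hcΩ hs) fun q hq => hp q.1 q.2 hq.2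
  -- The pull-back of Φ (b ↷ x) is the derivative at t = 0 of the pull-backs of Φ x by c t, which
  -- are closed for every t.
  have heq : chartForm ((c 0).pull (Φ (grafting b x) (c 0))) (cotProj G z) =ᶠ[
      𝓝 (extChartAt 𝓘(ℝ, E) (cotProj G z) (cotProj G z))]
      paramDeriv fun t => chartForm ((c t).pull (Φ x (c t))) (cotProj G z) := by
    filter_upwards [hW.mem_nhds hzW] with q hq
    have e : paramDeriv (fun t => chartForm ((c t).pull (Φ x (c t))) (cotProj G z)) q =
        paramDeriv (fun t => locPull ((c t).inChart z) (chartForm (Φ x (c t)) z)) q := by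
      rw [paramDeriv, paramDeriv]
      congr 1
      exact funext fun t => hp t q hq
    rw [e, paramDeriv_locPull hS (isOpen_cotChartOver z hW) hW h0 hc hcΩ hs hq
      (fun u v => by rw [hċ]; exact fderiv_chartForm_symm hψ.1 hψ.2 (hWt hq) u v), hċ,
      (c 0).chartForm_pull _ (hWt hq), locPull, locPull, hd _ (hcΩ 0 h0 q hq)]
    rfl
  refine extDer_eq_zero _ fun u v => ?_
  rw [heq.fderiv_eq]
  exact fderiv_paramDeriv_symm hS hW h0 hP hzW (fun t _ u v =>
    fderiv_chartForm_symm (hx (c t)).1 (hx (c t)).2 (hWt hzW) u v) u v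

/-- The b for which all pull-backs of Φ b are closed form a subspace which contains the one-node
tree and is stable under grafting. Generation under grafting, rather than attaching, makes it the
whole space. -/
theorem map_grafting_eq_zero_of_closed (hΦ : ∀ x, Φ x ∈ smoothFamilies G)
    (hgen : Φ treeGen = fun _ => ξ) (hatt : ∀ x y, Φ (attaching x y) = etaMap (Φ x) (Φ y))
    (hξ : ∀ (ζ : ClosedSection G) (x : M), extDer (ζ.pull ξ) x = 0)
    (b : TreeSpace) {x : TreeSpace} (hx : Φ x = 0) : Φ (grafting b x) = 0 := by
  let p : Submodule ℝ TreeSpace :=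
    { carrier := {b | ∀ ζ : ClosedSection G, ζ.pull (Φ b ζ) ∈ closedForms 𝓘(ℝ, E) M}
      zero_mem' := fun ζ => by
        have e : ζ.pull (Φ 0 ζ) = 0 := by
          rw [map_zero]; exact funext fun _ => ContinuousLinearMap.zero_comp _
        rw [e]; exact zero_mem _
      add_mem' := fun {u v} hu hv ζ => by
        rw [map_add]; exact add_mem (hu ζ) (hv ζ)
      smul_mem' := fun r u hu ζ => by
        rw [map_smul]; exact Submodule.smul_mem _ r (hu ζ) }
  suffices h : p = ⊤ from
    map_grafting_eq_zero_right hΦ hgen hatt (h ▸ Submodule.mem_top : b ∈ p) hx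
  refine generatedBy_grafting p (fun ζ => ⟨ζ.chartSmooth_pull (mem_smoothFamilies.1 (hΦ _) ζ),
    fun x => ?_⟩) fun u hu v hv => pull_map_grafting_mem_closedForms hΦ hgen hatt hu hv
  rw [hgen]
  exact hξ ζ x

end Directional

/-! ## Existence and uniqueness of the product -/

section Product

variable {E : Type*} [NormedAddCommGroup E] [NormedSpace ℝ E] [FiniteDimensional ℝ E]
  {M : Type*} [TopologicalSpace M] [T2Space M] [ChartedSpace E M] [IsManifold 𝓘(ℝ, E) ∞ M]
  {G : TopologicalSpace.Opens (CotangentBundle E M)} {ξ : OneForm (cotModel E) G}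

/-- The algebraic criterion asks that grafting preserve the kernel of the elementary differential;
the directional derivative formula supplies exactly this. -/
theorem existsUnique_isJetProduct (hξ : ChartSmooth ξ)
    (hcl : ∀ (ζ : ClosedSection G) (x : M), extDer (ζ.pull ξ) x = 0) :
    ∃! m : jetSpace ξ →ₗ[ℝ] jetSpace ξ →ₗ[ℝ] jetSpace ξ, IsJetProduct ξ m := by
  refine existsUnique_derivation_product (F := elemDiffLin hξ) (generatedBy_jetEtaBilin hξ)
    (elemDiffLin_treeGen hξ) (elemDiffLin_attaching hξ) fun b x hx => ?_
  let Φ : TreeSpace →ₗ[ℝ] FormFamily G := (jetSpace ξ).subtype.comp (elemDiffLin hξ)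
  exact Subtype.ext (map_grafting_eq_zero_of_closed (Φ := Φ) (ξ := ξ)
    (fun x => jetSpace_le_smoothFamilies hξ (elemDiffLin hξ x).2)
    (congrArg Subtype.val (elemDiffLin_treeGen hξ))
    (fun x y => congrArg Subtype.val (elemDiffLin_attaching hξ x y)) hcl b
    (congrArg Subtype.val hx))

end Product

end

-- The proposition

theorem mainTheorem7
    {E : Type*} [NormedAddCommGroup E] [NormedSpace ℝ E] [FiniteDimensional ℝ E]
    {M : Type*} [TopologicalSpace M] [T2Space M] [SecondCountableTopology M]
    [ChartedSpace E M] [IsManifold 𝓘(ℝ, E) ∞ M]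
    (G : TopologicalSpace.Opens (CotangentBundle E M))
    (hG : ∀ x : M, (⟨x, 0⟩ : CotangentBundle E M) ∈ G)
    (ξ : OneForm (cotModel E) G) (hξ : IsSmoothForm ξ) :
    IsLeftPreLie grafting ∧
    ∃ F : TreeSpace →ₗ[ℝ] jetSpace ξ,
      (∀ t : PlanarTree,
        (F (Finsupp.single (ButcherTree.mk t) 1) : FormFamily G) = elemDiff ξ t) ∧
      (∀ m : jetSpace ξ →ₗ[ℝ] jetSpace ξ →ₗ[ℝ] jetSpace ξ, IsJetProduct ξ m →
        IsLeftPreLie (V := jetSpace ξ) m ∧ ∀ a b : TreeSpace, F (grafting a b) = m (F a) (F b)) ∧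
      ((∀ (ζ : ClosedSection G) (x : M), extDer (ζ.pull ξ) x = 0) →
        ∃! m : jetSpace ξ →ₗ[ℝ] jetSpace ξ →ₗ[ℝ] jetSpace ξ, IsJetProduct ξ m) := by
  have h := isSmoothForm_iff.1 hξ
  exact ⟨isLeftPreLie_grafting, elemDiffLin h,
    fun t => congrArg Subtype.val (elemDiffLin_single h (ButcherTree.mk t)),
    fun m hm => ⟨isLeftPreLie_of_isJetProduct h hm, elemDiffLin_grafting h hm⟩,
    fun hcl => existsUnique_isJetProduct h hcl⟩
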